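/- Let $k$ be a field of characteristic $\neq 2$. A Hurwitz superalgebra over $k$ is a unital superalgebra $C=C_{\bar 0}\oplus C_{\bar 1}$ with a regular quadratic superform $q=(q_{\bar 0},\mathrm b)$ (that is, $q_{\bar 0}$ is a quadratic form on $C_{\bar 0}$, $\mathrm b$ is an even supersymmetric bilinear form on $C$ which restricts to the polar form of $q_{\bar 0}$ on $C_{\bar 0}$, and $\mathrm b$ is nondegenerate on $C_{\bar 0}$ and on $C_{\bar 1}$) such that $q_{\bar 0}(x_0y_0)=q_{\bar 0}(x_0)q_{\bar 0}(y_0)$, $\mathrm b(x_0y,x_0z)=q_{\bar 0}(x_0)\mathrm b(y,z)=\mathrm b(yx_0,zx_0)$ and $\mathrm b(xy,zt)+(-1)^{|x||y|+|x||z|+|y||z|}\mathrm b(zy,xt)=(-1)^{|y||z|}\mathrm b(x,z)\mathrm b(y,t)$ for $x_0,y_0\in C_{\bar 0}$ and homogeneous $x,y,z,t\in C$. Put $\bar x=\mathrm b(x,1)1-x$. The para-Hurwitz superalgebra $S$ attached to $C$ is the superspace $C$ with the same norm and the product $x\bullet y=\bar x\bar y$. In particular, $S_1=k1$ is the para-Hurwitz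 algebra attached to the Hurwitz algebra $k$ with norm $x\mapsto x^2$. For a superspace $V$, the parity $i$ part of $\mathrm{End}(V)$ consists of the linear maps sending $V_{\bar\jmath}$ to $V_{\bar\imath+\bar\jmath}$, and $[f,g]=fg-(-1)^{|f||g|}gf$. For $S$ as above, $\mathfrak{osp}(S,q)_{\bar\imath}$ consists of the $d\in\mathrm{End}(S)_{\bar\imath}$ with $\mathrm b(d(x),y)+(-1)^{i|x|}\mathrm b(x,d(y))=0$, and the triality Lie superalgebra is $\mathfrak{tri}(S)=\mathfrak{tri}(S)_{\bar 0}\oplus\mathfrak{tri}(S)_{\bar 1}$ with the componentwise bracket, where $$\mathfrak{tri}(S)_{\bar\imath}=\{(d_0,d_1,d_2)\in\mathfrak{osp}(S,q)_{\bar\imath}^3:\ d_0(x\bullet y)=d_1(x)\bullet y+(-1)^{i|x|}x\bullet d_2(y)\ \text{for all homogeneous } x,y\}.$$ Put $\theta(d_0,d_1,d_2)=(d_2,d_0,d_1)$ and, for homogeneous $x,y$, $t_{x,y}=(\sigma_{x,y},\tfrac12\mathrm b(x,y)1-r_xl_y,\tfrac12\mathrm b(x,y)1-l_xr_y)$ with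 $l_x(z)=x\bullet z$, $r_x(z)=(-1)^{|x||z|}z\bullet x$ and $\sigma_{x,y}(z)=(-1)^{|y||z|}\mathrm b(x,z)y-(-1)^{|x|(|y|+|z|)}\mathrm b(y,z)x$. For two para-Hurwitz superalgebras $S',S$ let $\mathfrak g(S',S)=\bigl(\mathfrak{tri}(S')\oplus\mathfrak{tri}(S)\bigr)\oplus\bigoplus_{i=0}^2\iota_i(S'\otimes S)$, where $\iota_i(S'\otimes S)$ is a copy of $S'\otimes S$, with the superanticommutative product such that $\mathfrak{tri}(S')\oplus\mathfrak{tri}(S)$ is a subalgebra (a direct sum of ideals of this subalgebra) and, with indices modulo $3$ and for homogeneous elements, $[(d'_0,d'_1,d'_2),\iota_i(x'\otimes x)]=\iota_i(d'_i(x')\otimes x)$, $[(d_0,d_1,d_2),\iota_i(x'\otimes x)]=(-1)^{|d_i||x'|}\iota_i(x'\otimes d_i(x))$, $[\iota_i(x'\otimes x),\iota_{i+1}(y'\otimes y)]=(-1)^{|x||y'|}\iota_{i+2}((x'\bullet y')\otimes(x\bullet y))$, and $$[\iota_i(x'\otimes x),\iota_i(y'\otimes y)]=(-1)^{|x'||x|+|x'||y|+|y'||y|}\mathrm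 b(x,y)\,\theta^i(t_{x',y'})+(-1)^{|y'||x|}\mathrm b(x',y')\,\theta^i(t_{x,y}),$$ for $(d'_0,d'_1,d'_2)\in\mathfrak{tri}(S')$, $(d_0,d_1,d_2)\in\mathfrak{tri}(S)$, $x',y'\in S'$, $x,y\in S$. Let $J=H_3(C,*)$ be the Jordan superalgebra of the $3\times 3$ matrices $(a_{ij})$ over $C$ with $a_{ij}=\bar a_{ji}$, with product $x\circ y=\tfrac12(xy+(-1)^{|x||y|}yx)$, and let $\mathrm{der}\,J\subseteq\mathrm{End}(J)$ be the Lie superalgebra of its superderivations. With rows and columns indexed by $\mathbb Z/3$, let $e_i\in J$ be the matrix with the single nonzero entry $1$ in position $(i,i)$, and for $a\in S$ let $\iota_i(a)\in J$ be the matrix with entries $2a$ in position $(i+2,i+1)$, $2\bar a$ in position $(i+1,i+2)$, and $0$ elsewhere. For $(d_0,d_1,d_2)\in\mathfrak{tri}(S)$ let $D_{(d_0,d_1,d_2)}$ be the linear endomorphism of $J$ with $D_{(d_0,d_1,d_2)}(e_i)=0$ and $D_{(d_0,d_1,d_2)}(\iota_i(a))=\iota_i(d_i(a))$, and let $D_i(a)=2[L_{\iota_i(a)},L_{e_{i+1}}]$,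 where $L_x(y)=x\circ y$. **Theorem.** Let $C$ be a Hurwitz superalgebra over a field of characteristic $\neq 2$, let $S$ be the attached para-Hurwitz superalgebra, and let $J=H_3(C,*)$. Then $\mathfrak g(S_1,S)$ and $\mathrm{der}\,J$ are Lie superalgebras, there is exactly one linear map $\Phi:\mathfrak g(S_1,S)\to\mathrm{der}\,J$ such that $$\Phi\bigl((d_0,d_1,d_2)\bigr)=D_{(d_0,d_1,d_2)},\qquad \Phi\bigl(\iota_i(1\otimes a)\bigr)=D_i(a)$$ for all $(d_0,d_1,d_2)\in\mathfrak{tri}(S)$, $a\in S$ and $i=0,1,2$, and $\Phi$ is an isomorphism of Lie superalgebras. -/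

import Mathlib

open scoped TensorProduct

noncomputable section

namespace SuperMagic

/-! ### Superspaces -/

/-- The sign `(-1)^i`, for a parity `i` in `ℤ/2`. -/
def sgn (k : Type*) [Field k] (i : ZMod 2) : k := if i = 0 then 1 else -1

/-- A superspace: a vector space `V` with a decomposition `V = V₀ ⊕ V₁`. -/
class Superspace (k : Type*) (V : Type*) [Field k] [AddCommGroup V] [Module k V] where
  part : ZMod 2 → Submodule k V
  isCompl : IsCompl (part 0) (part 1)

section Superspace

variable {k : Type*} [Field k]

lemma parity_cases (i : ZMod 2) : i = 0 ∨ i = 1 := by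
  revert i; decide

@[simp] lemma sgn_zero : sgn k 0 = 1 := by simp [sgn]

@[simp] lemma sgn_one : sgn k 1 = -1 := by simp [sgn]

lemma sgn_mul_self (i : ZMod 2) : sgn k i * sgn k i = 1 := by
  rcases parity_cases i with rfl | rfl <;> simp

@[simp] lemma one_add_one_parity : (1 + 1 : ZMod 2) = 0 := by decide

lemma sum_parity {M : Type*} [AddCommMonoid M] (f : ZMod 2 → M) : ∑ i, f i = f 0 + f 1 :=
  Fin.sum_univ_two f

variable (k) (V : Type*) [AddCommGroup V] [Module k V] [Superspace k V]

/-- The homogeneous component `V_i` of a superspace. -/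
def gr (i : ZMod 2) : Submodule k V := Superspace.part i

variable {V}

/-- The projection of a superspace onto its homogeneous component of parity `i`. -/
def proj (i : ZMod 2) : V →ₗ[k] V :=
  if i = 0 then (gr k V 0).projection (gr k V 1) Superspace.isCompl
  else (gr k V 1).projection (gr k V 0) Superspace.isCompl.symm

variable {k}

lemma proj_mem (i : ZMod 2) (x : V) : proj k i x ∈ gr k V i := by
  rcases parity_cases i with rfl | rfl <;>
    simp only [proj, if_true, one_ne_zero, if_false] <;>
    exact Submodule.projection_apply_mem _ _

lemma proj_of_mem {i : ZMod 2} {x : V} (hx : x ∈ gr k V i) : proj k i x = x := by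
  rcases parity_cases i with rfl | rfl <;>
    simp only [proj, if_true, one_ne_zero, if_false] <;>
    exact Submodule.projection_apply_of_mem_left _ hx

lemma proj_of_mem_ne {i j : ZMod 2} {x : V} (hx : x ∈ gr k V i) (h : j ≠ i) :
    proj k j x = 0 := by
  rcases parity_cases i with rfl | rfl <;> rcases parity_cases j with rfl | rfl <;>
    first
    | exact absurd rfl h
    | (simp only [proj, if_true, one_ne_zero, if_false]
       exact (Submodule.projection_apply_eq_zero_iff _).2 hx)

lemma proj_add_proj (x : V) : proj k 0 x + proj k 1 x = x := by
  simp only [proj, if_true, one_ne_zero, if_false]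
  exact Submodule.projection_add_projection_eq_self _ x

@[elab_as_elim]
lemma hom_induction {P : V → Prop} (hom : ∀ i, ∀ x ∈ gr k V i, P x)
    (add : ∀ x y, P x → P y → P (x + y)) (x : V) : P x := by
  rw [← proj_add_proj (k := k) x]
  exact add _ _ (hom 0 _ (proj_mem 0 x)) (hom 1 _ (proj_mem 1 x))

/-- Two subspaces with a compatible pair of projections form a superspace. -/
@[reducible]
def Superspace.ofProj {W : Type*} [AddCommGroup W] [Module k W] (N : ZMod 2 → Submodule k W)
    (P : ZMod 2 → W →ₗ[k] W) (hmem : ∀ i x, P i x ∈ N i) (hsum : ∀ x, P 0 x + P 1 x = x)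
    (hzero : ∀ i, ∀ x ∈ N i, P (i + 1) x = 0) : Superspace k W where
  part := N
  isCompl := by
    constructor
    · rw [Submodule.disjoint_def]
      intro x h0 h1
      have a := hzero 0 x h0
      have b := hzero 1 x h1
      rw [one_add_one_parity] at b
      rw [zero_add] at a
      rw [← hsum x, a, b, add_zero]
    · rw [codisjoint_iff, eq_top_iff]
      intro x _
      rw [← hsum x]
      exact Submodule.add_mem_sup (hmem 0 x) (hmem 1 x)

end Superspace

section Constructions

variable {k : Type*} [Field k] {V W : Type*} [AddCommGroup V] [Module k V] [Superspace k V]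
  [AddCommGroup W] [Module k W] [Superspace k W]

/-- The ground field, as a purely even superspace. -/
instance : Superspace k k where
  part i := if i = 0 then ⊤ else ⊥
  isCompl := by simpa using isCompl_top_bot

instance : Superspace k (V × W) :=
  Superspace.ofProj (fun i => (gr k V i).prod (gr k W i)) (fun i => (proj k i).prodMap (proj k i))
    (fun i x => ⟨proj_mem i _, proj_mem i _⟩)
    (fun x => Prod.ext (proj_add_proj _) (proj_add_proj _))
    (fun i x hx => Prod.ext (proj_of_mem_ne hx.1 (by simp)) (proj_of_mem_ne hx.2 (by simp)))

instance {ι : Type*} : Superspace k (ι → V) :=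
  Superspace.ofProj (fun i => Submodule.pi Set.univ (fun _ => gr k V i)) (fun i => LinearMap.pi fun m => (proj k i) ∘ₗ LinearMap.proj m)
    (fun i x m _ => proj_mem i _)
    (fun x => funext fun m => proj_add_proj _)
    (fun i x hx => funext fun m => proj_of_mem_ne (hx m trivial) (by simp))

instance {m n : Type*} : Superspace k (Matrix m n V) :=
  inferInstanceAs (Superspace k (m → n → V))

/-- The linear maps of parity `i`: those sending `V_j` to `V_{i+j}` for all `j`. -/
def endPart (k V : Type*) [Field k] [AddCommGroup V] [Module k V] [Superspace k V] (i : ZMod 2) :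
    Submodule k (Module.End k V) where
  carrier := {f | ∀ j, ∀ x ∈ gr k V j, f x ∈ gr k V (i + j)}
  add_mem' hf hg j x hx := add_mem (hf j x hx) (hg j x hx)
  zero_mem' _ _ _ := zero_mem _
  smul_mem' c _ hf j x hx := Submodule.smul_mem _ c (hf j x hx)

instance : Superspace k (Module.End k V) :=
  Superspace.ofProj (endPart k V)
    (fun i => ∑ j : ZMod 2,
      (LinearMap.lcomp k V (proj k j)) ∘ₗ (LinearMap.llcomp k V V V (proj k (i + j))))
    (by
      intro i f j x hx
      simp only [LinearMap.sum_apply, LinearMap.comp_apply, LinearMap.lcomp_apply,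
        LinearMap.llcomp_apply]
      refine Submodule.sum_mem _ fun l _ => ?_
      by_cases h : l = j
      · subst h; exact proj_mem _ _
      · rw [proj_of_mem_ne hx h]; simp)
    (by
      intro f
      ext x
      simp only [LinearMap.add_apply, LinearMap.comp_apply,
        LinearMap.lcomp_apply, LinearMap.llcomp_apply, sum_parity, one_add_one_parity, zero_add,
        add_zero]
      have h0 := proj_add_proj (k := k) (f (proj k 0 x))
      have h1 := proj_add_proj (k := k) (f (proj k 1 x))
      have h2 : f (proj k 0 x) + f (proj k 1 x) = f x := by rw [← map_add, proj_add_proj]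
      rw [← h2]
      nth_rewrite 3 [← h0]
      nth_rewrite 3 [← h1]
      abel)
    (by
      intro i f hf
      ext x
      simp only [LinearMap.sum_apply, LinearMap.comp_apply, LinearMap.lcomp_apply,
        LinearMap.llcomp_apply, LinearMap.zero_apply]
      refine Finset.sum_eq_zero fun j _ => proj_of_mem_ne (hf j _ (proj_mem j x)) ?_
      rw [add_right_comm]
      simp)

/-- `(V ⊗ W)_i` is the sum of the spaces `V_j ⊗ W_l` with `j + l = i`. -/
instance : Superspace k (V ⊗[k] W) :=
  Superspace.ofProj (fun i => ⨆ j : ZMod 2, Submodule.map₂ (TensorProduct.mk k V W) (gr k V j) (gr k W (i + j)))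
    (fun i => ∑ j : ZMod 2, TensorProduct.map (proj k j) (proj k (i + j)))
    (by
      intro i x
      rw [LinearMap.sum_apply]
      refine Submodule.sum_mem _ fun j _ => ?_
      induction x with
      | zero => simp
      | add x y hx hy => rw [map_add]; exact add_mem hx hy
      | tmul x y =>
        exact Submodule.mem_iSup_of_mem j
          (Submodule.apply_mem_map₂ _ (proj_mem _ _) (proj_mem _ _)))
    (by
      intro x
      induction x with
      | zero => simp
      | add x y hx hy => rw [map_add, map_add, add_add_add_comm, hx, hy]
      | tmul x y =>
        simp only [LinearMap.add_apply, TensorProduct.map_tmul, sum_parity,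
          one_add_one_parity, zero_add, add_zero]
        nth_rewrite 5 [← proj_add_proj (k := k) x]
        nth_rewrite 5 [← proj_add_proj (k := k) y]
        simp only [TensorProduct.add_tmul, TensorProduct.tmul_add]
        abel)
    (by
      intro i x hx
      rw [← LinearMap.mem_ker]
      refine (iSup_le fun j => Submodule.map₂_le.2 fun v hv w hw => ?_ : _ ≤ LinearMap.ker _) hx
      rw [LinearMap.mem_ker, LinearMap.sum_apply]
      refine Finset.sum_eq_zero fun l _ => ?_
      rw [TensorProduct.mk_apply, TensorProduct.map_tmul]
      by_cases h : l = j
      · subst h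
        rw [proj_of_mem_ne hw (by rw [add_right_comm]; simp), TensorProduct.tmul_zero]
      · rw [proj_of_mem_ne hv h, TensorProduct.zero_tmul])

/-- A subspace stable under the two projections inherits the decomposition. -/
@[reducible]
def Superspace.ofStable (N : Submodule k V) (h : ∀ i, ∀ x ∈ N, proj k i x ∈ N) :
    Superspace k N :=
  Superspace.ofProj (fun i => (gr k V i).comap N.subtype) (fun i => ((proj k i) ∘ₗ N.subtype).codRestrict N fun x => h i x x.2)
    (fun i x => proj_mem i _)
    (fun x => Subtype.ext (proj_add_proj _))
    (fun i x hx => Subtype.ext (proj_of_mem_ne (x := (x : V)) hx (by simp)))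

lemma proj_mem_iSup {N : ZMod 2 → Submodule k V} (h : ∀ i, N i ≤ gr k V i) (i : ZMod 2) (x : V)
    (hx : x ∈ ⨆ i, N i) : proj k i x ∈ N i := by
  refine (iSup_le fun j y hy => ?_ : _ ≤ (N i).comap (proj k i)) hx
  by_cases hij : i = j
  · subst hij; simpa [proj_of_mem (h i hy)] using hy
  · simp [proj_of_mem_ne (h j hy) hij]

/-- The sum `N₀ ⊕ N₁` of two subspaces `N_i ⊆ V_i`, as a superspace. -/
@[reducible]
def Superspace.ofParts (N : ZMod 2 → Submodule k V) (h : ∀ i, N i ≤ gr k V i) :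
    Superspace k (⨆ i, N i : Submodule k V) :=
  Superspace.ofProj (fun i => (N i).comap (⨆ i, N i).subtype)
    (fun i => ((proj k i) ∘ₗ (⨆ i, N i).subtype).codRestrict _ fun x =>
      Submodule.mem_iSup_of_mem i (proj_mem_iSup h i x x.2))
    (fun i x => proj_mem_iSup h i x x.2)
    (fun x => Subtype.ext (proj_add_proj _))
    (fun i x hx => Subtype.ext (proj_of_mem_ne (h i hx) (by simp)))

/-- The restriction to `N₀ ⊕ N₁` of a bilinear map that takes `N_i × N_j` to `N_{i+j}`. -/
def restrictBilin (N : ZMod 2 → Submodule k V) (B : V →ₗ[k] V →ₗ[k] V)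
    (h : ∀ i j, ∀ x ∈ N i, ∀ y ∈ N j, B x y ∈ N (i + j)) :
    (⨆ i, N i : Submodule k V) →ₗ[k] (⨆ i, N i : Submodule k V) →ₗ[k]
      (⨆ i, N i : Submodule k V) :=
  have hB : ∀ x ∈ ⨆ i, N i, ∀ y ∈ ⨆ i, N i, B x y ∈ ⨆ i, N i := by
    intro x hx y hy
    have h1 : Submodule.map₂ B (⨆ i, N i) (⨆ i, N i) ≤ ⨆ i, N i := by
      rw [Submodule.map₂_iSup_left]
      refine iSup_le fun i => ?_
      rw [Submodule.map₂_iSup_right]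
      refine iSup_le fun j => Submodule.map₂_le.2 fun u hu v hv => ?_
      exact Submodule.mem_iSup_of_mem _ (h i j u hu v hv)
    exact h1 (Submodule.apply_mem_map₂ B hx hy)
  LinearMap.mk₂ k (fun x y => ⟨B x y, hB x x.2 y y.2⟩)
    (fun x x' y => by ext; simp) (fun c x y => by ext; simp)
    (fun x y y' => by ext; simp) (fun c x y => by ext; simp)

/-- The bilinear map `(y, x) ↦ (-1)^{|x||y|} B(x, y)`. -/
def superFlip {X : Type*} [AddCommGroup X] [Module k X] (B : V →ₗ[k] W →ₗ[k] X) :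
    W →ₗ[k] V →ₗ[k] X :=
  ∑ i : ZMod 2, ∑ j : ZMod 2, sgn k (i * j) • B.flip.compl₁₂ (proj k i) (proj k j)

lemma superFlip_apply {X : Type*} [AddCommGroup X] [Module k X] (B : V →ₗ[k] W →ₗ[k] X)
    {i j : ZMod 2} {y : W} {x : V} (hy : y ∈ gr k W i) (hx : x ∈ gr k V j) :
    superFlip B y x = sgn k (i * j) • B x y := by
  simp only [superFlip, LinearMap.sum_apply, LinearMap.smul_apply, LinearMap.compl₁₂_apply,
    LinearMap.flip_apply]
  rw [Finset.sum_eq_single i, Finset.sum_eq_single j, proj_of_mem hy, proj_of_mem hx]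
  · intro l _ hl
    simp [proj_of_mem_ne hx hl]
  · simp
  · intro l _ hl
    simp [proj_of_mem_ne hy hl]
  · simp

/-- The bilinear map `(x, y) ↦ B(x, y) - (-1)^{|x||y|} B(y, x)`. -/
def superSkew {X : Type*} [AddCommGroup X] [Module k X] (B : V →ₗ[k] V →ₗ[k] X) :
    V →ₗ[k] V →ₗ[k] X :=
  B - superFlip B

end Constructions

/-! ### Lie superalgebras -/

section Lie

variable {k : Type*} [Field k] {V W : Type*} [AddCommGroup V] [Module k V] [Superspace k V]
  [AddCommGroup W] [Module k W] [Superspace k W]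

/-- A bilinear product on a superspace makes it a Lie superalgebra. The last two conditions are
those needed in characteristics `2` and `3`. -/
structure IsLieSuperalgebra (br : V →ₗ[k] V →ₗ[k] V) : Prop where
  even : ∀ i j, ∀ x ∈ gr k V i, ∀ y ∈ gr k V j, br x y ∈ gr k V (i + j)
  skew : ∀ i j, ∀ x ∈ gr k V i, ∀ y ∈ gr k V j, br x y = -(sgn k (i * j) • br y x)
  jacobi : ∀ i j l, ∀ x ∈ gr k V i, ∀ y ∈ gr k V j, ∀ z ∈ gr k V l,
    br x (br y z) = br (br x y) z + sgn k (i * j) • br y (br x z)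
  self_even : ∀ x ∈ gr k V 0, br x x = 0
  self_odd : ∀ x ∈ gr k V 1, br x (br x x) = 0

/-- `f` is an isomorphism of (Lie) superalgebras: a bijective linear map that preserves the
parity and the product. -/
structure IsSuperIso (br : V →ₗ[k] V →ₗ[k] V) (br' : W →ₗ[k] W →ₗ[k] W) (f : V →ₗ[k] W) :
    Prop where
  bijective : Function.Bijective f
  even : ∀ i, ∀ x ∈ gr k V i, f x ∈ gr k W i
  map_br : ∀ x y, f (br x y) = br' (f x) (f y)

/-- The supercommutator `[f, g] = fg - (-1)^{|f||g|} gf` in `End(V)`. -/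
def superComm (k V : Type*) [Field k] [AddCommGroup V] [Module k V] [Superspace k V] :
    Module.End k V →ₗ[k] Module.End k V →ₗ[k] Module.End k V :=
  superSkew (LinearMap.mul k (Module.End k V))

lemma superComm_apply {i j : ZMod 2} {f g : Module.End k V} (hf : f ∈ gr k (Module.End k V) i)
    (hg : g ∈ gr k (Module.End k V) j) (x : V) :
    superComm k V f g x = f (g x) - sgn k (i * j) • g (f x) := by
  simp [superComm, superSkew, superFlip_apply _ hf hg]

lemma superComm_mem {i j : ZMod 2} {f g : Module.End k V} (hf : f ∈ gr k (Module.End k V) i)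
    (hg : g ∈ gr k (Module.End k V) j) : superComm k V f g ∈ gr k (Module.End k V) (i + j) := by
  intro l x hx
  rw [superComm_apply hf hg]
  refine sub_mem ?_ (Submodule.smul_mem _ _ ?_)
  · rw [add_assoc]; exact hf _ _ (hg _ _ hx)
  · rw [add_comm i j, add_assoc]; exact hg _ _ (hf _ _ hx)

/-- The superderivations of parity `i` of a superalgebra with product `p`. -/
def derPart (p : V →ₗ[k] V →ₗ[k] V) (i : ZMod 2) : Submodule k (Module.End k V) where
  carrier := {d | d ∈ gr k (Module.End k V) i ∧ ∀ j, ∀ x ∈ gr k V j, ∀ y,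
    d (p x y) = p (d x) y + sgn k (i * j) • p x (d y)}
  add_mem' := by
    rintro d f ⟨hd, hd'⟩ ⟨hf, hf'⟩
    refine ⟨add_mem hd hf, fun j x hx y => ?_⟩
    simp only [LinearMap.add_apply, hd' j x hx, hf' j x hx, map_add]
    module
  zero_mem' := ⟨zero_mem _, fun j x hx y => by simp⟩
  smul_mem' := by
    rintro c d ⟨hd, hd'⟩
    refine ⟨Submodule.smul_mem _ c hd, fun j x hx y => ?_⟩
    simp only [LinearMap.smul_apply, hd' j x hx, map_smul]
    module

/-- The superspace `der = der₀ ⊕ der₁` of superderivations. -/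
def Der (p : V →ₗ[k] V →ₗ[k] V) : Submodule k (Module.End k V) := ⨆ i, derPart p i

instance (p : V →ₗ[k] V →ₗ[k] V) : Superspace k (Der p) :=
  Superspace.ofParts (derPart p) fun _ _ hd => hd.1

/-- The bracket of `Der p`: the supercommutator. -/
def derBracket (p : V →ₗ[k] V →ₗ[k] V) : Der p →ₗ[k] Der p →ₗ[k] Der p :=
  restrictBilin (derPart p) (superComm k V) (by
    rintro i j d ⟨hd, hd'⟩ f ⟨hf, hf'⟩
    refine ⟨superComm_mem hd hf, fun l x hx y => ?_⟩
    simp only [superComm_apply hd hf]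
    rw [hf' l x hx, hd' l x hx, map_add, map_add, map_smul, map_smul,
      hd' _ _ (hf _ _ hx), hd' l x hx, hf' _ _ (hd _ _ hx), hf' l x hx]
    rcases parity_cases i with rfl | rfl <;> rcases parity_cases j with rfl | rfl <;>
      rcases parity_cases l with rfl | rfl <;> simp <;> abel)

end Lie

/-! ### Composition superalgebras -/

/-- A composition superalgebra over a field of characteristic not `2` (the regularity of the
norm then means that the even form `b` is nondegenerate on `V₀` and on `V₁`). -/
structure CompositionSuperalgebra (k V : Type*) [Field k] [AddCommGroup V] [Module k V]
    [Superspace k V] where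
  mul : V →ₗ[k] V →ₗ[k] V
  mul_mem : ∀ i j, ∀ x ∈ gr k V i, ∀ y ∈ gr k V j, mul x y ∈ gr k V (i + j)
  q : QuadraticForm k (gr k V 0)
  b : V →ₗ[k] V →ₗ[k] k
  b_even : ∀ i j, ∀ x ∈ gr k V i, ∀ y ∈ gr k V j, i ≠ j → b x y = 0
  b_symm : ∀ i j, ∀ x ∈ gr k V i, ∀ y ∈ gr k V j, b x y = sgn k (i * j) * b y x
  b_polar : ∀ x y : gr k V 0, b x y = q (x + y) - q x - q y
  regular : ∀ i, ∀ x ∈ gr k V i, (∀ y ∈ gr k V i, b x y = 0) → x = 0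
  q_mul : ∀ x y z : gr k V 0, (z : V) = mul x y → q z = q x * q y
  b_mul_left : ∀ (x : gr k V 0) (y z : V), b (mul x y) (mul x z) = q x * b y z
  b_mul_right : ∀ (x : gr k V 0) (y z : V), b (mul y x) (mul z x) = q x * b y z
  b_mul_mul : ∀ i j l m, ∀ x ∈ gr k V i, ∀ y ∈ gr k V j, ∀ z ∈ gr k V l, ∀ t ∈ gr k V m,
    b (mul x y) (mul z t) + sgn k (i * j + i * l + j * l) * b (mul z y) (mul x t) =
      sgn k (j * l) * b x z * b y t

/-- A symmetric composition superalgebra. -/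
structure SymmetricCompositionSuperalgebra (k V : Type*) [Field k] [AddCommGroup V] [Module k V]
    [Superspace k V] extends CompositionSuperalgebra k V where
  assoc : ∀ x y z, b (mul x y) z = b x (mul y z)

/-- A Hurwitz superalgebra: a unital composition superalgebra (the unit is necessarily even). -/
structure HurwitzSuperalgebra (k V : Type*) [Field k] [AddCommGroup V] [Module k V]
    [Superspace k V] extends CompositionSuperalgebra k V where
  one : V
  one_mem : one ∈ gr k V 0
  one_mul : ∀ x, mul one x = x
  mul_one : ∀ x, mul x one = x

section Composition

variable {k : Type*} [Field k] {V : Type*} [AddCommGroup V] [Module k V] [Superspace k V]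

namespace CompositionSuperalgebra

variable (C : CompositionSuperalgebra k V)

lemma ext_b {x x' : V} (h : ∀ j, ∀ y ∈ gr k V j, C.b x y = C.b x' y) : x = x' := by
  have key : ∀ i, proj k i (x - x') = 0 := by
    intro i
    refine C.regular i _ (proj_mem _ _) fun y hy => ?_
    have h1 : C.b (x - x') y = 0 := by rw [map_sub, LinearMap.sub_apply, h i y hy, sub_self]
    rw [← proj_add_proj (k := k) (x - x'), map_add, LinearMap.add_apply] at h1
    rcases parity_cases i with rfl | rfl
    · rwa [C.b_even 1 0 _ (proj_mem _ _) y hy (by simp), add_zero] at h1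
    · rwa [C.b_even 0 1 _ (proj_mem _ _) y hy (by simp), zero_add] at h1
  rw [← sub_eq_zero, ← proj_add_proj (k := k) (x - x'), key, key, add_zero]

end CompositionSuperalgebra

namespace HurwitzSuperalgebra

variable (C : HurwitzSuperalgebra k V)

/-- The standard involution `x ↦ b(x, 1) 1 - x`. -/
def conj : V →ₗ[k] V := (C.b.flip C.one).smulRight C.one - LinearMap.id

lemma conj_apply (x : V) : C.conj x = C.b x C.one • C.one - x := by simp [conj]

lemma conj_mem (i : ZMod 2) (x : V) (hx : x ∈ gr k V i) : C.conj x ∈ gr k V i := by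
  rw [conj_apply]
  refine sub_mem ?_ hx
  rcases parity_cases i with rfl | rfl
  · exact Submodule.smul_mem _ _ C.one_mem
  · rw [C.b_even 1 0 x hx _ C.one_mem (by simp), zero_smul]; exact zero_mem _

lemma b_one_one_mul (x y : V) : C.b C.one C.one * C.b x y = 2 * C.b x y := by
  have h1 := C.b_mul_left ⟨C.one, C.one_mem⟩ x y
  have h2 := C.b_polar ⟨C.one, C.one_mem⟩ ⟨C.one, C.one_mem⟩
  have h3 := QuadraticMap.map_smul C.q (2 : k) ⟨C.one, C.one_mem⟩
  rw [two_smul, smul_eq_mul] at h3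
  simp only [one_mul] at h1
  simp only at h2
  rw [h2, h3]
  linear_combination (-2) * h1

lemma b_one (x : V) : C.b C.one x = C.b x C.one := by
  refine hom_induction (k := k) (fun i x hx => ?_) (fun x y hx hy => ?_) x
  · simpa using C.b_symm 0 i _ C.one_mem x hx
  · simp [hx, hy]

lemma b_one_one_smul : C.b C.one C.one • C.one = (2 : k) • C.one :=
  C.ext_b fun j y _ => by
    rw [map_smul, map_smul, LinearMap.smul_apply, LinearMap.smul_apply, smul_eq_mul, smul_eq_mul,
      C.b_one_one_mul]

@[simp] lemma conj_one : C.conj C.one = C.one := by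
  rw [conj_apply, b_one_one_smul]; module

@[simp] lemma conj_conj (x : V) : C.conj (C.conj x) = x := by
  have := C.b_one_one_mul x C.one
  simp only [conj_apply, map_sub, map_smul, LinearMap.sub_apply, LinearMap.smul_apply,
    smul_eq_mul]
  linear_combination (norm := module) this • C.one

lemma b_conj_conj (x y : V) : C.b (C.conj x) (C.conj y) = C.b x y := by
  have := C.b_one_one_mul x C.one
  simp only [conj_apply, map_sub, map_smul, LinearMap.sub_apply, LinearMap.smul_apply, smul_eq_mul,
    b_one]
  linear_combination C.b y C.one * this

lemma b_conj (x y : V) : C.b (C.conj x) y = C.b x (C.conj y) := by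
  rw [← b_conj_conj, conj_conj]

lemma b_mul_eq_left {i j : ZMod 2} {x y : V} (hx : x ∈ gr k V i) (hy : y ∈ gr k V j) (t : V) :
    C.b (C.mul x y) t = sgn k (i * j) * C.b y (C.mul (C.conj x) t) := by
  refine hom_induction (k := k) (fun m t ht => ?_) (fun s t hs ht => ?_) t
  · have h := C.b_mul_mul i j 0 m x hx y hy _ C.one_mem t ht
    simp only [one_mul, mul_zero, add_zero, sgn_zero] at h
    simp only [conj_apply, map_sub, map_smul, LinearMap.sub_apply, LinearMap.smul_apply,
      smul_eq_mul, C.one_mul]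
    rcases parity_cases i with rfl | rfl
    · simp at h ⊢; linear_combination h
    · rw [C.b_even 1 0 x hx _ C.one_mem (by simp)] at h ⊢
      linear_combination h
  · simp only [map_add, hs, ht]; ring

lemma b_mul_eq_right {i j l : ZMod 2} {x y z : V} (hx : x ∈ gr k V i) (hy : y ∈ gr k V j)
    (hz : z ∈ gr k V l) :
    C.b (C.mul x y) z = sgn k (j * l) * C.b x (C.mul z (C.conj y)) := by
  have h := C.b_mul_mul i j l 0 x hx y hy z hz _ C.one_mem
  simp only [C.mul_one] at h
  rw [C.b_symm _ _ _ (C.mul_mem _ _ z hz y hy) x hx] at h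
  simp only [conj_apply, map_sub, map_smul, smul_eq_mul, C.mul_one]
  rcases parity_cases i with rfl | rfl <;> rcases parity_cases j with rfl | rfl <;>
    rcases parity_cases l with rfl | rfl <;> simp at h ⊢ <;> linear_combination h

lemma conj_mul {i j : ZMod 2} {x y : V} (hx : x ∈ gr k V i) (hy : y ∈ gr k V j) :
    C.conj (C.mul x y) = sgn k (i * j) • C.mul (C.conj y) (C.conj x) := by
  refine C.ext_b fun l w hw => ?_
  have hw' := C.conj_mem l w hw
  have hx' := C.conj_mem i x hx
  have hy' := C.conj_mem j y hy
  have h1 := C.b_mul_eq_left hx hy (C.conj w)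
  have h2 := C.b_mul_eq_right hx' hw' hy
  have h3 := C.b_mul_eq_left hy hw (C.conj x)
  rw [C.b_symm _ _ y hy _ (C.mul_mem _ _ _ hx' _ hw'), h2, conj_conj,
    C.b_symm _ _ _ hx' _ (C.mul_mem _ _ _ hy _ hw), h3,
    C.b_symm _ _ w hw _ (C.mul_mem _ _ _ hy' _ hx')] at h1
  rw [b_conj, h1, map_smul, LinearMap.smul_apply, smul_eq_mul]
  rcases parity_cases i with rfl | rfl <;> rcases parity_cases j with rfl | rfl <;>
    rcases parity_cases l with rfl | rfl <;> simp

lemma q_eq (C : CompositionSuperalgebra k V) (x : gr k V 0) : 2 * C.q x = C.b x x := by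
  have h3 := QuadraticMap.map_smul C.q (2 : k) x
  rw [two_smul, smul_eq_mul] at h3
  rw [C.b_polar, h3]
  ring

variable [NeZero (2 : k)]

lemma q_conj (x : gr k V 0) : C.q ⟨C.conj x, C.conj_mem 0 x x.2⟩ = C.q x := by
  apply mul_left_cancel₀ (NeZero.ne (2 : k))
  rw [q_eq, q_eq, b_conj_conj]

/-- The para-Hurwitz superalgebra attached to a Hurwitz superalgebra (over a field of
characteristic not `2`): the product is `x • y = x̄ ȳ`, the grading and the norm are the same. -/
def para : SymmetricCompositionSuperalgebra k V where
  mul := C.mul.compl₁₂ C.conj C.conj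
  mul_mem i j x hx y hy := C.mul_mem i j _ (C.conj_mem i x hx) _ (C.conj_mem j y hy)
  q := C.q
  b := C.b
  b_even := C.b_even
  b_symm := C.b_symm
  b_polar := C.b_polar
  regular := C.regular
  q_mul x y z h := by
    rw [C.q_mul ⟨C.conj x, C.conj_mem 0 x x.2⟩ ⟨C.conj y, C.conj_mem 0 y y.2⟩ z h, q_conj, q_conj]
  b_mul_left x y z := by
    have := C.b_mul_left ⟨C.conj x, C.conj_mem 0 x x.2⟩ (C.conj y) (C.conj z)
    rwa [q_conj, b_conj_conj] at this
  b_mul_right x y z := by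
    have := C.b_mul_right ⟨C.conj x, C.conj_mem 0 x x.2⟩ (C.conj y) (C.conj z)
    rwa [q_conj, b_conj_conj] at this
  b_mul_mul i j l m x hx y hy z hz t ht := by
    have := C.b_mul_mul i j l m _ (C.conj_mem i x hx) _ (C.conj_mem j y hy) _
      (C.conj_mem l z hz) _ (C.conj_mem m t ht)
    rwa [b_conj_conj, b_conj_conj] at this
  assoc x y z := by
    simp only [LinearMap.compl₁₂_apply]
    refine hom_induction (k := k) (fun i x hx => ?_)
      (fun x x' h h' => by simp only [map_add, LinearMap.add_apply, h, h']) x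
    refine hom_induction (k := k) (fun j y hy => ?_)
      (fun x x' h h' => by simp only [map_add, LinearMap.add_apply, h, h']) y
    refine hom_induction (k := k) (fun l z hz => ?_)
      (fun x x' h h' => by simp only [map_add, h, h']) z
    have h1 := C.b_mul_eq_right (C.conj_mem i x hx) (C.conj_mem j y hy) hz
    rw [conj_conj] at h1
    rw [h1, b_conj, C.conj_mul hz hy, map_smul, smul_eq_mul, mul_comm l j,
      ← mul_assoc, sgn_mul_self, _root_.one_mul]

end HurwitzSuperalgebra

end Composition

lemma mem_gr_self_zero {k : Type*} [Field k] (x : k) : x ∈ gr k k 0 := trivial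

lemma mem_gr_self_one {k : Type*} [Field k] {x : k} (hx : x ∈ gr k k 1) : x = 0 := hx

/-- The ground field as a Hurwitz superalgebra, with norm `q(x) = x²`. -/
def HurwitzSuperalgebra.ground (k : Type*) [Field k] [NeZero (2 : k)] : HurwitzSuperalgebra k k where
  mul := LinearMap.mul k k
  mul_mem i j x hx y hy := by
    rcases parity_cases i with rfl | rfl
    · rcases parity_cases j with rfl | rfl
      · exact mem_gr_self_zero _
      · simp [mem_gr_self_one hy]
    · simp [mem_gr_self_one hx]
  q := QuadraticMap.sq.comp (gr k k 0).subtype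
  b := (2 : k) • LinearMap.mul k k
  b_even i j x hx y hy hij := by
    rcases parity_cases i with rfl | rfl
    · rcases parity_cases j with rfl | rfl
      · exact absurd rfl hij
      · simp [mem_gr_self_one hy]
    · simp [mem_gr_self_one hx]
  b_symm i j x hx y hy := by
    rcases parity_cases i with rfl | rfl
    · simp [mul_comm x y]
    · simp [mem_gr_self_one hx]
  b_polar x y := by
    simp; ring
  regular i x hx h := by
    rcases parity_cases i with rfl | rfl
    · simpa [NeZero.ne (2 : k)] using h 1 (mem_gr_self_zero _)
    · exact mem_gr_self_one hx
  q_mul x y z h := by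
    simp [h]; ring
  b_mul_left x y z := by simp; ring
  b_mul_right x y z := by simp; ring
  b_mul_mul i j l m x hx y hy z hz t ht := by
    rcases parity_cases i with rfl | rfl
    · rcases parity_cases j with rfl | rfl
      · simp; ring
      · simp [mem_gr_self_one hy]
    · simp [mem_gr_self_one hx]
  one := 1
  one_mem := mem_gr_self_zero _
  one_mul := by simp
  mul_one := by simp

/-! ### The triality Lie superalgebra -/

section Triality

variable {k : Type*} [Field k] {V : Type*} [AddCommGroup V] [Module k V] [Superspace k V]

namespace CompositionSuperalgebra

variable (S : CompositionSuperalgebra k V)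

/-- The component `osp(S, q)_i` of the orthosymplectic Lie superalgebra (characteristic not `2`). -/
def ospPart (i : ZMod 2) : Submodule k (Module.End k V) where
  carrier := {d | d ∈ gr k (Module.End k V) i ∧ ∀ j, ∀ x ∈ gr k V j, ∀ y,
    S.b (d x) y + sgn k (i * j) * S.b x (d y) = 0}
  add_mem' := by
    rintro d f ⟨hd, hd'⟩ ⟨hf, hf'⟩
    refine ⟨add_mem hd hf, fun j x hx y => ?_⟩
    simp only [LinearMap.add_apply, map_add]
    linear_combination hd' j x hx y + hf' j x hx y
  zero_mem' := ⟨zero_mem _, fun j x hx y => by simp⟩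
  smul_mem' := by
    rintro c d ⟨hd, hd'⟩
    refine ⟨Submodule.smul_mem _ c hd, fun j x hx y => ?_⟩
    simp only [LinearMap.smul_apply, map_smul, smul_eq_mul]
    linear_combination c * hd' j x hx y

/-- The component `tri(S)_i`: the triples `(d 0, d 1, d 2)` of elements of `osp(S, q)_i` with
`d 0 (x • y) = d 1 (x) • y + (-1)^{i|x|} x • d 2 (y)`. -/
def triPart (i : ZMod 2) : Submodule k (Fin 3 → Module.End k V) where
  carrier := {d | (∀ m, d m ∈ S.ospPart i) ∧ ∀ j, ∀ x ∈ gr k V j, ∀ y,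
    d 0 (S.mul x y) = S.mul (d 1 x) y + sgn k (i * j) • S.mul x (d 2 y)}
  add_mem' := by
    rintro d f ⟨hd, hd'⟩ ⟨hf, hf'⟩
    refine ⟨fun m => add_mem (hd m) (hf m), fun j x hx y => ?_⟩
    simp only [Pi.add_apply, LinearMap.add_apply, hd' j x hx, hf' j x hx, map_add]
    module
  zero_mem' := ⟨fun _ => zero_mem _, fun j x hx y => by simp⟩
  smul_mem' := by
    rintro c d ⟨hd, hd'⟩
    refine ⟨fun m => Submodule.smul_mem _ c (hd m), fun j x hx y => ?_⟩
    simp only [Pi.smul_apply, LinearMap.smul_apply, hd' j x hx, map_smul]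
    module

lemma triPart_le (i : ZMod 2) : S.triPart i ≤ gr k (Fin 3 → Module.End k V) i :=
  fun _ hd m _ => (hd.1 m).1

/-- The triality Lie superalgebra `tri(S) = tri(S)₀ ⊕ tri(S)₁`, as a subspace of `End(S)³`. -/
def tri : Submodule k (Fin 3 → Module.End k V) := ⨆ i, S.triPart i

instance : Superspace k S.tri := Superspace.ofParts S.triPart S.triPart_le

lemma superComm_mem_osp {i j : ZMod 2} {d f : Module.End k V} (hd : d ∈ S.ospPart i)
    (hf : f ∈ S.ospPart j) : superComm k V d f ∈ S.ospPart (i + j) := by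
  refine ⟨superComm_mem hd.1 hf.1, fun l x hx y => ?_⟩
  have h1 := hd.2 _ _ (hf.1 _ _ hx) y
  have h2 := hf.2 _ _ (hd.1 _ _ hx) y
  have h3 := hf.2 _ _ hx (d y)
  have h4 := hd.2 _ _ hx (f y)
  simp only [superComm_apply hd.1 hf.1, map_sub, map_smul, LinearMap.sub_apply,
    LinearMap.smul_apply, smul_eq_mul]
  rcases parity_cases i with rfl | rfl <;> rcases parity_cases j with rfl | rfl <;>
    rcases parity_cases l with rfl | rfl <;> simp at * <;> grind

/-- The componentwise bracket of `tri(S)`. -/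
def triBracket : S.tri →ₗ[k] S.tri →ₗ[k] S.tri :=
  restrictBilin S.triPart
    (LinearMap.mk₂ k (fun d f m => superComm k V (d m) (f m))
      (fun d d' f => by ext; simp) (fun c d f => by ext; simp)
      (fun d f f' => by ext; simp) (fun c d f => by ext; simp))
    (by
      rintro i j d ⟨hd, hd'⟩ f ⟨hf, hf'⟩
      refine ⟨fun m => S.superComm_mem_osp (hd m) (hf m), fun l x hx y => ?_⟩
      simp only [LinearMap.mk₂_apply, superComm_apply (hd _).1 (hf _).1]
      rw [hf' l x hx, hd' l x hx, map_add, map_add, map_smul, map_smul,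
        hd' _ _ ((hf 1).1 _ _ hx), hd' l x hx, hf' _ _ ((hd 1).1 _ _ hx), hf' l x hx]
      rcases parity_cases i with rfl | rfl <;> rcases parity_cases j with rfl | rfl <;>
        rcases parity_cases l with rfl | rfl <;> simp <;> abel)

/-- `l_x(y) = x • y`. -/
def l : V →ₗ[k] Module.End k V := S.mul

/-- `r_x(y) = (-1)^{|x||y|} y • x`. -/
def r : V →ₗ[k] Module.End k V := superFlip S.mul

/-- `σ_{x,y}(z)` for `x, y` and the component of parity `n` of `z`, where `x` and `y` have
parities `i` and `j`. -/
def sigmaAux (i j n : ZMod 2) : V →ₗ[k] V →ₗ[k] Module.End k V :=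
  LinearMap.mk₂ k
    (fun x y => sgn k (j * n) • (S.b x ∘ₗ proj k n).smulRight y -
      sgn k (i * (j + n)) • (S.b y ∘ₗ proj k n).smulRight x)
    (fun x x' y => by ext; simp; module) (fun c x y => by ext; simp; module)
    (fun x y y' => by ext; simp; module) (fun c x y => by ext; simp; module)

/-- `σ_{x,y}(z) = (-1)^{|y||z|} b(x,z) y - (-1)^{|x|(|y|+|z|)} b(y,z) x`. -/
def sigma : V →ₗ[k] V →ₗ[k] Module.End k V :=
  ∑ i : ZMod 2, ∑ j : ZMod 2, ∑ n : ZMod 2, (S.sigmaAux i j n).compl₁₂ (proj k i) (proj k j)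

/-- The triple `t_{x,y} = (σ_{x,y}, ½ b(x,y) 1 - r_x l_y, ½ b(x,y) 1 - l_x r_y)`. -/
def t : V →ₗ[k] V →ₗ[k] (Fin 3 → Module.End k V) :=
  LinearMap.mk₂ k
    (fun x y => ![S.sigma x y, (2⁻¹ * S.b x y) • 1 - S.r x * S.l y,
      (2⁻¹ * S.b x y) • 1 - S.l x * S.r y])
    (fun x x' y => by
      ext m; fin_cases m <;> simp [add_mul] <;> module)
    (fun c x y => by
      ext m; fin_cases m <;> simp <;> module)
    (fun x y y' => by
      ext m; fin_cases m <;> simp [mul_add] <;> module)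
    (fun c x y => by
      ext m; fin_cases m <;> simp <;> module)

lemma sigma_apply {i j n : ZMod 2} {x y z : V} (hx : x ∈ gr k V i) (hy : y ∈ gr k V j)
    (hz : z ∈ gr k V n) :
    S.sigma x y z = (sgn k (j * n) * S.b x z) • y - (sgn k (i * (j + n)) * S.b y z) • x := by
  simp only [sigma, LinearMap.sum_apply, LinearMap.compl₁₂_apply]
  rw [Finset.sum_eq_single i, Finset.sum_eq_single j, Finset.sum_eq_single n]
  · simp [sigmaAux, proj_of_mem hx, proj_of_mem hy, proj_of_mem hz, mul_smul]
  · intro n' _ h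
    simp [sigmaAux, proj_of_mem_ne hz h]
  · simp
  · intro j' _ h
    simp [proj_of_mem_ne hy h]
  · simp
  · intro i' _ h
    simp [proj_of_mem_ne hx h]
  · simp

lemma t_one_apply {i j n : ZMod 2} {x y z : V} (hx : x ∈ gr k V i) (hy : y ∈ gr k V j)
    (hz : z ∈ gr k V n) : S.t x y 1 z =
      (2⁻¹ * S.b x y) • z - sgn k (i * (j + n)) • S.mul (S.mul y z) x := by
  simp [t, r, l, superFlip_apply S.mul hx (S.mul_mem _ _ y hy z hz)]

lemma t_two_apply {j n : ZMod 2} {x y z : V} (hy : y ∈ gr k V j)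
    (hz : z ∈ gr k V n) : S.t x y 2 z =
      (2⁻¹ * S.b x y) • z - sgn k (j * n) • S.mul x (S.mul z y) := by
  simp [t, r, l, superFlip_apply S.mul hy hz]

lemma b_symm' {j : ZMod 2} {y : V} (hy : y ∈ gr k V j) (x : V) :
    S.b x y = sgn k j * S.b y x := by
  refine hom_induction (k := k) (fun i x hx => ?_) (fun w w' h h' => ?_) x
  · have h1 := S.b_symm i j x hx y hy
    have h2 := S.b_even i j x hx y hy
    rcases parity_cases i with rfl | rfl <;> rcases parity_cases j with rfl | rfl <;>
      simp at h1 h2 ⊢ <;> grind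
  · simp only [map_add, LinearMap.add_apply, h, h']; ring

lemma ext_b' {x x' : V} (h : ∀ j, ∀ y ∈ gr k V j, S.b y x = S.b y x') : x = x' :=
  S.ext_b fun j y hy => by rw [S.b_symm' hy, S.b_symm' hy, h j y hy]

end CompositionSuperalgebra

namespace SymmetricCompositionSuperalgebra

variable (S : SymmetricCompositionSuperalgebra k V)

lemma mul_mul_left {i j l : ZMod 2} {x y z : V} (hx : x ∈ gr k V i) (hy : y ∈ gr k V j)
    (hz : z ∈ gr k V l) :
    S.mul (S.mul x y) z + sgn k (i * j + i * l + j * l) • S.mul (S.mul z y) x =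
      (sgn k (j * l) * S.b x z) • y := by
  refine S.ext_b fun m t ht => ?_
  simp only [map_add, map_smul, LinearMap.add_apply, LinearMap.smul_apply, smul_eq_mul, S.assoc]
  rw [← S.assoc, ← S.assoc, ← S.b_mul_mul i j l m x hx y hy z hz t ht]
  simp only [S.assoc]

lemma mul_mul_right {i j l : ZMod 2} {x y z : V} (hx : x ∈ gr k V i) (hy : y ∈ gr k V j)
    (hz : z ∈ gr k V l) :
    S.mul x (S.mul y z) + sgn k (i * j + i * l + j * l) • S.mul z (S.mul y x) =
      (sgn k (i * j) * S.b x z) • y := by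
  refine S.ext_b fun m t ht => ?_
  have h := S.b_mul_mul m i j l t ht x hx y hy z hz
  have h1 := S.b_symm _ _ _ (S.mul_mem _ _ x hx _ (S.mul_mem _ _ y hy z hz)) t ht
  have h2 := S.b_symm _ _ _ (S.mul_mem _ _ z hz _ (S.mul_mem _ _ y hy x hx)) t ht
  have h3 := S.b_symm _ _ y hy t ht
  have h4 := S.b_symm _ _ _ (S.mul_mem _ _ y hy x hx) _ (S.mul_mem _ _ t ht z hz)
  have h5 := S.b_even _ _ x hx z hz
  have h6 := S.b_even _ _ t ht y hy
  simp only [map_add, map_smul, LinearMap.add_apply, LinearMap.smul_apply, smul_eq_mul]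
  rw [← S.assoc] at h1 h2
  rw [h1, h2, h3]
  rw [h4] at h
  rcases parity_cases i with rfl | rfl <;> rcases parity_cases j with rfl | rfl <;>
    rcases parity_cases l with rfl | rfl <;> rcases parity_cases m with rfl | rfl <;>
    simp at h h5 h6 ⊢ <;> grind

lemma rot_mem {i : ZMod 2} {d : Fin 3 → Module.End k V} (hd : d ∈ S.triPart i) :
    (fun m => d (m + 1)) ∈ S.triPart i := by
  refine ⟨fun m => hd.1 _, fun j y hy z => S.ext_b' fun m x hx => ?_⟩
  have h0 := congrArg (fun w => S.b w z) (hd.2 m x hx y)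
  have h1 := (hd.1 0).2 _ _ (S.mul_mem _ _ x hx y hy) z
  have h2 := (hd.1 1).2 _ x hx (S.mul y z)
  simp only [map_add, map_smul, LinearMap.add_apply, LinearMap.smul_apply, smul_eq_mul,
    S.assoc] at h0 h1 ⊢
  rw [h0] at h1
  have e : (2 + 1 : Fin 3) = 0 := rfl
  have e' : (1 + 1 : Fin 3) = 2 := rfl
  simp only [zero_add, e, e']
  rcases parity_cases i with rfl | rfl <;> rcases parity_cases j with rfl | rfl <;>
    rcases parity_cases m with rfl | rfl <;> simp at h1 h2 ⊢ <;> grind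

/-- The automorphism `θ : (d₀, d₁, d₂) ↦ (d₂, d₀, d₁)` of `tri(S)`. -/
def theta : Module.End k S.tri :=
  (LinearMap.funLeft k (Module.End k V) (fun m : Fin 3 => m - 1)).restrict (p := S.tri)
    (q := S.tri) (fun d hd => by
      refine (iSup_le fun i d hd => ?_ : S.tri ≤ S.tri.comap _) hd
      refine Submodule.mem_iSup_of_mem i ?_
      convert S.rot_mem (S.rot_mem hd) using 1
      funext m
      fin_cases m <;> rfl)

lemma sigma_mem {i j : ZMod 2} {x y : V} (hx : x ∈ gr k V i) (hy : y ∈ gr k V j) :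
    S.sigma x y ∈ S.ospPart (i + j) := by
  constructor
  · intro l z hz
    rw [S.sigma_apply hx hy hz]
    refine sub_mem ?_ ?_
    · by_cases h : i = l
      · subst h
        rw [add_right_comm]
        refine Submodule.smul_mem _ _ ?_
        rcases parity_cases i with rfl | rfl <;> simpa
      · rw [S.b_even _ _ x hx z hz h]; simp
    · by_cases h : j = l
      · subst h
        rw [add_assoc]
        refine Submodule.smul_mem _ _ ?_
        rcases parity_cases j with rfl | rfl <;> simpa
      · rw [S.b_even _ _ y hy z hz h]; simp
  · intro l z hz w
    refine hom_induction (k := k) (fun m w hw => ?_) (fun w w' h h' => ?_) w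
    · rw [S.sigma_apply hx hy hz, S.sigma_apply hx hy hw]
      have h1 := S.b_symm _ _ x hx z hz
      have h2 := S.b_symm _ _ y hy z hz
      have h3 := S.b_even _ _ x hx z hz
      have h4 := S.b_even _ _ y hy z hz
      have h5 := S.b_even _ _ x hx w hw
      have h6 := S.b_even _ _ y hy w hw
      simp only [map_sub, map_smul, LinearMap.sub_apply, LinearMap.smul_apply, smul_eq_mul]
      rcases parity_cases i with rfl | rfl <;> rcases parity_cases j with rfl | rfl <;>
        rcases parity_cases l with rfl | rfl <;> rcases parity_cases m with rfl | rfl <;>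
        simp at h1 h2 h3 h4 h5 h6 ⊢ <;> grind
    · simp only [map_add]
      linear_combination h + h'


end SymmetricCompositionSuperalgebra

end Triality

section Triality

variable {k : Type*} [Field k] {V : Type*} [AddCommGroup V] [Module k V] [Superspace k V]

namespace SymmetricCompositionSuperalgebra

variable (S : SymmetricCompositionSuperalgebra k V) [NeZero (2 : k)]

lemma t_one_mem {i j : ZMod 2} {x y : V} (hx : x ∈ gr k V i) (hy : y ∈ gr k V j) :
    S.t x y 1 ∈ S.ospPart (i + j) := by
  constructor
  · intro l z hz
    rw [S.t_one_apply hx hy hz]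
    refine sub_mem ?_ (Submodule.smul_mem _ _ ?_)
    · by_cases h : i = j
      · subst h
        refine Submodule.smul_mem _ _ ?_
        rcases parity_cases i with rfl | rfl <;> simpa
      · rw [S.b_even _ _ x hx y hy h]; simp
    · rw [add_assoc, add_comm i]
      exact S.mul_mem _ _ _ (S.mul_mem _ _ y hy z hz) x hx
  · intro l z hz w
    refine hom_induction (k := k) (fun m w hw => ?_) (fun w w' h h' => ?_) w
    · rw [S.t_one_apply hx hy hz, S.t_one_apply hx hy hw]
      have h1 := S.b_symm _ _ z hz _ (S.mul_mem _ _ _ (S.mul_mem _ _ y hy w hw) x hx)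
      have h2 := S.b_mul_mul j l i m y hy z hz x hx w hw
      have h3 := S.b_symm _ _ x hx y hy
      have h4 := S.b_even _ _ x hx y hy
      have h5 := S.b_even _ _ z hz w hw
      have h6 := S.b_symm _ _ _ (S.mul_mem _ _ x hx z hz) _ (S.mul_mem _ _ y hy w hw)
      have h7 := S.b_even _ _ _ (S.mul_mem _ _ x hx z hz) _ (S.mul_mem _ _ y hy w hw)
      have h8 := S.b_even _ _ _ (S.mul_mem _ _ y hy z hz) _ (S.mul_mem _ _ x hx w hw)
      have h9 := S.b_symm _ _ _ (S.mul_mem _ _ y hy z hz) _ (S.mul_mem _ _ x hx w hw)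
      simp only [map_sub, map_smul, LinearMap.sub_apply, LinearMap.smul_apply, smul_eq_mul]
      rw [S.assoc] at h1
      rw [h1, S.assoc]
      have hc : (2 : k) * 2⁻¹ = 1 := mul_inv_cancel₀ (NeZero.ne _)
      generalize (2⁻¹ : k) = c at *
      rcases parity_cases i with rfl | rfl <;> rcases parity_cases j with rfl | rfl <;>
        rcases parity_cases l with rfl | rfl <;> rcases parity_cases m with rfl | rfl <;>
        simp at h2 h3 h4 h5 h6 h7 h8 h9 ⊢ <;> grind
    · simp only [map_add]
      linear_combination h + h'


lemma t_two_mem {i j : ZMod 2} {x y : V} (hx : x ∈ gr k V i) (hy : y ∈ gr k V j) :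
    S.t x y 2 ∈ S.ospPart (i + j) := by
  constructor
  · intro l z hz
    rw [S.t_two_apply hy hz]
    refine sub_mem ?_ (Submodule.smul_mem _ _ ?_)
    · by_cases h : i = j
      · subst h
        refine Submodule.smul_mem _ _ ?_
        rcases parity_cases i with rfl | rfl <;> simpa
      · rw [S.b_even _ _ x hx y hy h]; simp
    · rw [add_assoc, add_comm j]
      exact S.mul_mem _ _ x hx _ (S.mul_mem _ _ z hz y hy)
  · intro l z hz w
    refine hom_induction (k := k) (fun m w hw => ?_) (fun w w' h h' => ?_) w
    · rw [S.t_two_apply hy hz, S.t_two_apply hy hw]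
      have h1 := S.b_symm _ _ _ (S.mul_mem _ _ x hx _ (S.mul_mem _ _ z hz y hy)) w hw
      have h2 := S.b_mul_mul l i m j z hz x hx w hw y hy
      have h3 := S.b_symm _ _ x hx y hy
      have h4 := S.b_even _ _ x hx y hy
      have h5 := S.b_even _ _ z hz w hw
      have h6 := S.b_symm _ _ _ (S.mul_mem _ _ w hw x hx) _ (S.mul_mem _ _ z hz y hy)
      have h7 := S.b_even _ _ _ (S.mul_mem _ _ w hw x hx) _ (S.mul_mem _ _ z hz y hy)
      have h8 := S.b_even _ _ _ (S.mul_mem _ _ z hz x hx) _ (S.mul_mem _ _ w hw y hy)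
      simp only [map_sub, map_smul, LinearMap.sub_apply, LinearMap.smul_apply, smul_eq_mul]
      rw [← S.assoc] at h1
      rw [h1, ← S.assoc z]
      have hc : (2 : k) * 2⁻¹ = 1 := mul_inv_cancel₀ (NeZero.ne _)
      generalize (2⁻¹ : k) = c at *
      rcases parity_cases i with rfl | rfl <;> rcases parity_cases j with rfl | rfl <;>
        rcases parity_cases l with rfl | rfl <;> rcases parity_cases m with rfl | rfl <;>
        simp at h2 h3 h4 h5 h6 h7 h8 ⊢ <;> grind
    · simp only [map_add]
      linear_combination h + h'

lemma t_mem {i j : ZMod 2} {x y : V} (hx : x ∈ gr k V i) (hy : y ∈ gr k V j) :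
    S.t x y ∈ S.triPart (i + j) := by
  constructor
  · intro m
    fin_cases m
    · exact S.sigma_mem hx hy
    · exact S.t_one_mem hx hy
    · exact S.t_two_mem hx hy
  · intro l z hz w
    refine hom_induction (k := k) (fun m w hw => ?_) (fun w w' h h' => ?_) w
    · change S.sigma x y _ = _
      rw [S.sigma_apply hx hy (S.mul_mem _ _ z hz w hw), S.t_one_apply hx hy hz,
        S.t_two_apply hy hw]
      have h1 := S.mul_mul_left (S.mul_mem _ _ x hx z hz) hy hw
      have h2 := congrArg (fun v => S.mul v w) (S.mul_mul_left hx hz hy)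
      have h3 := S.mul_mul_right hz hx (S.mul_mem _ _ w hw y hy)
      have h4 := S.b_even _ _ x hx y hy
      have h5 := S.b_even _ _ _ (S.mul_mem _ _ z hz w hw) y hy
      have h6 := S.b_symm _ _ y hy _ (S.mul_mem _ _ z hz w hw)
      have h7 := S.b_even _ _ x hx _ (S.mul_mem _ _ z hz w hw)
      simp only [map_add, map_smul, map_sub, LinearMap.add_apply, LinearMap.smul_apply,
        LinearMap.sub_apply] at h2 ⊢
      rw [S.assoc] at h1
      rw [← S.assoc] at h3
      have hc : (2 : k) * 2⁻¹ = 1 := mul_inv_cancel₀ (NeZero.ne _)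
      generalize (2⁻¹ : k) = c at *
      generalize S.b x (S.mul z w) = p at *
      generalize S.b y (S.mul z w) = q at *
      generalize S.b (S.mul z w) y = q' at *
      generalize S.b x y = u at *
      linear_combination (norm := skip) (-sgn k (j * l)) • h1 + sgn k (j * l) • h2 +
        sgn k ((i + j) * l + j * m) • h3
      rcases parity_cases i with rfl | rfl <;> rcases parity_cases j with rfl | rfl <;>
        rcases parity_cases l with rfl | rfl <;> rcases parity_cases m with rfl | rfl <;>
        simp only [mul_zero, mul_one, zero_add, add_zero, one_add_one_parity, sgn_zero, sgn_one,
          ne_eq, not_true_eq_false, false_imp_iff, zero_ne_one, one_ne_zero, not_false_eq_true,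
          true_imp_iff] at h4 h5 h6 h7 ⊢ <;>
        match_scalars <;> grind
    · simp only [map_add, h, h']
      module

end SymmetricCompositionSuperalgebra

end Triality

section Magic

variable {k : Type*} [Field k] [NeZero (2 : k)]

/-- The map `t : S × S → tri(S)`, `(x, y) ↦ t_{x,y}`. -/
def SymmetricCompositionSuperalgebra.tTri {V : Type*} [AddCommGroup V] [Module k V]
    [Superspace k V] (S : SymmetricCompositionSuperalgebra k V) : V →ₗ[k] V →ₗ[k] S.tri :=
  have h : ∀ x y, S.t x y ∈ S.tri := fun x y => by
    refine hom_induction (k := k) (fun i x hx => ?_) (fun x x' h h' => ?_) x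
    · refine hom_induction (k := k) (fun j y hy => ?_) (fun y y' h h' => ?_) y
      · exact Submodule.mem_iSup_of_mem _ (S.t_mem hx hy)
      · rw [map_add]; exact add_mem h h'
    · rw [map_add, LinearMap.add_apply]; exact add_mem h h'
  LinearMap.mk₂ k (fun x y => ⟨S.t x y, h x y⟩)
    (fun x x' y => by ext1; simp) (fun c x y => by ext1; simp)
    (fun x y y' => by ext1; simp) (fun c x y => by ext1; simp)

variable {V V' : Type*} [AddCommGroup V] [Module k V] [Superspace k V]
  [AddCommGroup V'] [Module k V'] [Superspace k V']

/-- For bilinear maps `f` and `g` and a function `s` of four parities, the bilinear map with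
`(x ⊗ x', y ⊗ y') ↦ (-1)^{s(|x|,|x'|,|y|,|y'|)} f(x, y) ⊗ g(x', y')`. -/
def signedTensor {X X' : Type*} [AddCommGroup X] [Module k X] [AddCommGroup X'] [Module k X']
    (s : ZMod 2 → ZMod 2 → ZMod 2 → ZMod 2 → ZMod 2)
    (f : V →ₗ[k] V →ₗ[k] X) (g : V' →ₗ[k] V' →ₗ[k] X') :
    V ⊗[k] V' →ₗ[k] V ⊗[k] V' →ₗ[k] X ⊗[k] X' :=
  ∑ i : ZMod 2, ∑ i' : ZMod 2, ∑ j : ZMod 2, ∑ j' : ZMod 2,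
    sgn k (s i i' j j') • (TensorProduct.map₂ f g).compl₁₂
      (TensorProduct.map (proj k i) (proj k i')) (TensorProduct.map (proj k j) (proj k j'))

/-- The bilinear map `(d', x ⊗ x') ↦ (-1)^{|d'||x|} x ⊗ d'(x')`. -/
def signedLTensor (k V V' : Type*) [Field k] [AddCommGroup V] [Module k V] [Superspace k V]
    [AddCommGroup V'] [Module k V'] [Superspace k V'] :
    Module.End k V' →ₗ[k] V ⊗[k] V' →ₗ[k] V ⊗[k] V' :=
  ∑ i : ZMod 2, ∑ j : ZMod 2, sgn k (i * j) •
    (LinearMap.lTensorHom V (R := k)).compl₁₂ (proj k i) (LinearMap.rTensor V' (proj k j))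

/-- The underlying superspace of `𝔤(S, S') = (tri(S) ⊕ tri(S')) ⊕ (⊕_{i=0}^{2} ι_i(S ⊗ S'))`; the
summands `ι_i(S ⊗ S')` are the three components of `Fin 3 → S ⊗ S'`. -/
def MagicAlgebra (S : SymmetricCompositionSuperalgebra k V)
    (S' : SymmetricCompositionSuperalgebra k V') : Type _ :=
  (S.tri × S'.tri) × (Fin 3 → V ⊗[k] V')

namespace MagicAlgebra

variable (S : SymmetricCompositionSuperalgebra k V) (S' : SymmetricCompositionSuperalgebra k V')

instance : AddCommGroup (MagicAlgebra S S') :=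
  inferInstanceAs (AddCommGroup ((S.tri × S'.tri) × (Fin 3 → V ⊗[k] V')))

instance : Module k (MagicAlgebra S S') :=
  inferInstanceAs (Module k ((S.tri × S'.tri) × (Fin 3 → V ⊗[k] V')))

instance : Superspace k (MagicAlgebra S S') :=
  inferInstanceAs (Superspace k ((S.tri × S'.tri) × (Fin 3 → V ⊗[k] V')))

/-- The inclusion `ι_i : S ⊗ S' → 𝔤(S, S')`. -/
def iota (i : Fin 3) : V ⊗[k] V' →ₗ[k] MagicAlgebra S S' :=
  LinearMap.inr k _ _ ∘ₗ LinearMap.single k (fun _ : Fin 3 => V ⊗[k] V') i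

/-- The inclusion of `tri(S)` in `𝔤(S, S')`. -/
def ofTri : S.tri →ₗ[k] MagicAlgebra S S' := LinearMap.inl k _ _ ∘ₗ LinearMap.inl k _ _

/-- The inclusion of `tri(S')` in `𝔤(S, S')`. -/
def ofTri' : S'.tri →ₗ[k] MagicAlgebra S S' := LinearMap.inl k _ _ ∘ₗ LinearMap.inr k _ _

/-- `(x ⊗ x', y ⊗ y') ↦ (-1)^{|x||x'|+|x||y'|+|y||y'|} b'(x',y') t_{x,y}`. -/
def toTri : V ⊗[k] V' →ₗ[k] V ⊗[k] V' →ₗ[k] S.tri :=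
  (signedTensor (fun i i' j j' => i * i' + i * j' + j * j') S.tTri S'.b).compr₂
    (TensorProduct.rid k S.tri).toLinearMap

/-- `(x ⊗ x', y ⊗ y') ↦ (-1)^{|y||x'|} b(x,y) t'_{x',y'}`. -/
def toTri' : V ⊗[k] V' →ₗ[k] V ⊗[k] V' →ₗ[k] S'.tri :=
  (signedTensor (fun _ i' j _ => j * i') S.b S'.tTri).compr₂
    (TensorProduct.lid k S'.tri).toLinearMap

/-- `(x ⊗ x', y ⊗ y') ↦ (-1)^{|x'||y|} (x • y) ⊗ (x' • y')`. -/
def tensorMul : V ⊗[k] V' →ₗ[k] V ⊗[k] V' →ₗ[k] V ⊗[k] V' :=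
  signedTensor (fun _ i' j _ => i' * j) S.mul S'.mul

/-- The projection `𝔤(S, S') → S ⊗ S'` with `ι_i(u) ↦ u`. -/
def comp (i : Fin 3) : MagicAlgebra S S' →ₗ[k] V ⊗[k] V' :=
  LinearMap.proj i ∘ₗ LinearMap.snd k _ _

/-- The projection `𝔤(S, S') → tri(S)`. -/
def triComp : MagicAlgebra S S' →ₗ[k] S.tri := LinearMap.fst k _ _ ∘ₗ LinearMap.fst k _ _

/-- The projection `𝔤(S, S') → tri(S')`. -/
def triComp' : MagicAlgebra S S' →ₗ[k] S'.tri := LinearMap.snd k _ _ ∘ₗ LinearMap.fst k _ _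

/-- The part of the bracket consisting of the products of two elements of `tri(S)` or of `tri(S')`
(with `[tri(S), tri(S')] = 0`), and of the products
`[ι_i(x ⊗ x'), ι_i(y ⊗ y')] = (-1)^{|x||x'|+|x||y'|+|y||y'|} b'(x',y') θ^i(t_{x,y})
  + (-1)^{|y||x'|} b(x,y) θ'^i(t'_{x',y'})`. -/
def diagPart : MagicAlgebra S S' →ₗ[k] MagicAlgebra S S' →ₗ[k] MagicAlgebra S S' :=
  (S.triBracket.compl₁₂ (triComp S S') (triComp S S')).compr₂ (ofTri S S') +
  (S'.triBracket.compl₁₂ (triComp' S S') (triComp' S S')).compr₂ (ofTri' S S') +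
  ∑ i : Fin 3,
    (((toTri S S').compl₁₂ (comp S S' i) (comp S S' i)).compr₂
        (ofTri S S' ∘ₗ S.theta ^ (i : ℕ)) +
      ((toTri' S S').compl₁₂ (comp S S' i) (comp S S' i)).compr₂
        (ofTri' S S' ∘ₗ S'.theta ^ (i : ℕ)))

/-- The part of the bracket consisting of the products, in this order,
`[(d_0,d_1,d_2), ι_i(x ⊗ x')] = ι_i(d_i(x) ⊗ x')`,
`[(d'_0,d'_1,d'_2), ι_i(x ⊗ x')] = (-1)^{|d'_i||x|} ι_i(x ⊗ d'_i(x'))`, and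
`[ι_i(x ⊗ x'), ι_{i+1}(y ⊗ y')] = (-1)^{|x'||y|} ι_{i+2}((x • y) ⊗ (x' • y'))`. -/
def upperPart : MagicAlgebra S S' →ₗ[k] MagicAlgebra S S' →ₗ[k] MagicAlgebra S S' :=
  ∑ i : Fin 3,
    (((LinearMap.rTensorHom V' (R := k)).compl₁₂
        (LinearMap.proj i ∘ₗ S.tri.subtype ∘ₗ triComp S S') (comp S S' i)).compr₂ (iota S S' i) +
      ((signedLTensor k V V').compl₁₂
        (LinearMap.proj i ∘ₗ S'.tri.subtype ∘ₗ triComp' S S') (comp S S' i)).compr₂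
          (iota S S' i) +
      ((tensorMul S S').compl₁₂ (comp S S' i) (comp S S' (i + 1))).compr₂ (iota S S' (i + 2)))

/-- The bracket of `𝔤(S, S')`: the superanticommutative product determined by `diagPart` and
`upperPart`. -/
def bracket : MagicAlgebra S S' →ₗ[k] MagicAlgebra S S' →ₗ[k] MagicAlgebra S S' :=
  diagPart S S' + superSkew (upperPart S S')

end MagicAlgebra

end Magic

/-! ### Hermitian matrices -/

namespace HurwitzSuperalgebra

variable {k : Type*} [Field k] {V : Type*} [AddCommGroup V] [Module k V] [Superspace k V]
  (C : HurwitzSuperalgebra k V)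

/-- The space `H₃(C, *)` of the matrices with `a_{ij} = conj a_{ji}`. -/
def H3 : Submodule k (Matrix (Fin 3) (Fin 3) V) where
  carrier := {A | ∀ i j, A i j = C.conj (A j i)}
  add_mem' hA hB i j := by
    rw [Matrix.add_apply, Matrix.add_apply, map_add, ← hA, ← hB]
  zero_mem' i j := by simp
  smul_mem' c A hA i j := by
    rw [Matrix.smul_apply, Matrix.smul_apply, map_smul, ← hA]

lemma conj_proj (i : ZMod 2) (x : V) : C.conj (proj k i x) = proj k i (C.conj x) := by
  have h : ∀ j, C.conj (proj k j x) ∈ gr k V j := fun j => C.conj_mem j _ (proj_mem j x)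
  conv_rhs => rw [← proj_add_proj (k := k) x, map_add, map_add]
  rcases parity_cases i with rfl | rfl
  · rw [proj_of_mem (h 0), proj_of_mem_ne (h 1) (by simp), add_zero]
  · rw [proj_of_mem (h 1), proj_of_mem_ne (h 0) (by simp), zero_add]

lemma proj_matrix {m n : Type*} (i : ZMod 2) (A : Matrix m n V) (a : m) (b : n) :
    proj k i A a b = proj k i (A a b) := by
  have h : ∀ j, (proj k j A) a b ∈ gr k V j := fun j =>
    proj_mem (k := k) j A a trivial b trivial
  have e : proj k 0 A a b + proj k 1 A a b = A a b :=
    congrFun (congrFun (proj_add_proj (k := k) A) a) b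
  rw [← e, map_add]
  rcases parity_cases i with rfl | rfl
  · rw [proj_of_mem (h 0), proj_of_mem_ne (h 1) (by simp), add_zero]
  · rw [proj_of_mem (h 1), proj_of_mem_ne (h 0) (by simp), zero_add]

instance : Superspace k C.H3 :=
  Superspace.ofStable C.H3 fun i A hA a b => by
    rw [proj_matrix, proj_matrix, conj_proj, ← hA a b]

/-- The product of matrices over `C`. -/
def matMul : Matrix (Fin 3) (Fin 3) V →ₗ[k] Matrix (Fin 3) (Fin 3) V →ₗ[k]
    Matrix (Fin 3) (Fin 3) V :=
  LinearMap.mk₂ k (fun A B => Matrix.of fun i j => ∑ l, C.mul (A i l) (B l j))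
    (fun A A' B => by ext; simp [Finset.sum_add_distrib])
    (fun c A B => by ext; simp [Finset.smul_sum])
    (fun A B B' => by ext; simp [Finset.sum_add_distrib])
    (fun c A B => by ext; simp [Finset.smul_sum])

/-- The product `A ∘ B = ½ (A B + (-1)^{|A||B|} B A)` on matrices over `C`. -/
def symMul : Matrix (Fin 3) (Fin 3) V →ₗ[k] Matrix (Fin 3) (Fin 3) V →ₗ[k]
    Matrix (Fin 3) (Fin 3) V :=
  (2⁻¹ : k) • (C.matMul + superFlip C.matMul)

lemma symMul_mem {A B : Matrix (Fin 3) (Fin 3) V} (hA : A ∈ C.H3) (hB : B ∈ C.H3) :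
    C.symMul A B ∈ C.H3 := by
  have key : ∀ i j, ∀ A : C.H3, A ∈ gr k C.H3 i → ∀ B : C.H3, B ∈ gr k C.H3 j →
      C.symMul A B ∈ C.H3 := by
    rintro i j ⟨A, hA⟩ hA' ⟨B, hB⟩ hB'
    have hA1 : A ∈ gr k (Matrix (Fin 3) (Fin 3) V) i := hA'
    have hB1 : B ∈ gr k (Matrix (Fin 3) (Fin 3) V) j := hB'
    have hm : ∀ a b, C.conj (C.matMul A B b a) = sgn k (i * j) • C.matMul B A a b := by
      intro a b
      simp only [matMul, LinearMap.mk₂_apply, Matrix.of_apply, map_sum, Finset.smul_sum]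
      refine Finset.sum_congr rfl fun l _ => ?_
      rw [C.conj_mul (hA1 b trivial l trivial) (hB1 l trivial a trivial), ← hA l b, ← hB a l]
    have hm' : ∀ a b, C.conj (C.matMul B A b a) = sgn k (i * j) • C.matMul A B a b := by
      intro a b
      simp only [matMul, LinearMap.mk₂_apply, Matrix.of_apply, map_sum, Finset.smul_sum]
      refine Finset.sum_congr rfl fun l _ => ?_
      rw [C.conj_mul (hB1 b trivial l trivial) (hA1 l trivial a trivial), ← hB l b, ← hA a l,
        mul_comm]
    intro a b
    simp only [symMul, LinearMap.smul_apply, LinearMap.add_apply, superFlip_apply _ hA1 hB1,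
      Matrix.smul_apply, Matrix.add_apply, map_smul, map_add, hm, hm', smul_smul, sgn_mul_self]
    module
  have h : ∀ A B : C.H3, C.symMul A B ∈ C.H3 := by
    intro A B
    refine hom_induction (k := k) (fun i A hA => ?_) (fun A A' h h' => ?_) A
    · refine hom_induction (k := k) (fun j B hB => ?_) (fun B B' h h' => ?_) B
      · exact key i j A hA B hB
      · rw [Submodule.coe_add, map_add]; exact add_mem h h'
    · rw [Submodule.coe_add, map_add, LinearMap.add_apply]; exact add_mem h h'
  exact h ⟨A, hA⟩ ⟨B, hB⟩

/-- The superspace `J = H₃(C, *)` as a type. -/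
def J : Type _ := C.H3

instance : AddCommGroup C.J := Submodule.addCommGroup C.H3

instance : Module k C.J := Submodule.module C.H3

instance : Superspace k C.J := inferInstanceAs (Superspace k ↥C.H3)

/-- The inclusion of `J = H₃(C, *)` in the space of all `3 × 3` matrices. -/
def toMatrix : C.J →ₗ[k] Matrix (Fin 3) (Fin 3) V := C.H3.subtype

/-- The hermitian matrices, as elements of `J`. -/
def ofHermitian (A : Matrix (Fin 3) (Fin 3) V) (hA : A ∈ C.H3) : C.J := ⟨A, hA⟩

lemma toMatrix_mem (A : C.J) : C.toMatrix A ∈ C.H3 := A.2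

@[simp] lemma toMatrix_ofHermitian (A : Matrix (Fin 3) (Fin 3) V) (hA : A ∈ C.H3) :
    C.toMatrix (C.ofHermitian A hA) = A := rfl

lemma toMatrix_injective : Function.Injective C.toMatrix := C.H3.injective_subtype

/-- The product of the Jordan superalgebra `J = H₃(C, *)`. -/
def jordanMul : C.J →ₗ[k] C.J →ₗ[k] C.J :=
  LinearMap.mk₂ k (fun A B => C.ofHermitian (C.symMul (C.toMatrix A) (C.toMatrix B))
      (C.symMul_mem (C.toMatrix_mem A) (C.toMatrix_mem B)))
    (fun A A' B => C.toMatrix_injective (by simp))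
    (fun c A B => C.toMatrix_injective (by simp))
    (fun A B B' => C.toMatrix_injective (by simp))
    (fun c A B => C.toMatrix_injective (by simp))

/-- The diagonal idempotents `e_i` of `J`. -/
def e (i : Fin 3) : C.J :=
  C.ofHermitian (Matrix.single i i C.one) fun a b => by
    simp only [Matrix.single_apply, and_comm (a := i = b)]
    split_ifs <;> simp

/-- The elements `ι_i(a)` of `J`: the matrix with the entry `2 a` at the place `(i+2, i+1)` and the
entry `2 ā` at the place `(i+1, i+2)` (indices modulo `3`). -/
def iota (i : Fin 3) (a : V) : C.J :=
  C.ofHermitian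
    ((2 : k) • (Matrix.single (i + 2) (i + 1) a + Matrix.single (i + 1) (i + 2) (C.conj a))) <|
    Submodule.smul_mem _ _ fun p r => by
      simp only [Matrix.add_apply, Matrix.single_apply, map_add,
        and_comm (a := i + 2 = r), and_comm (a := i + 1 = r)]
      rw [add_comm]
      split_ifs <;> simp

/-- The inner derivation `D_i(a) = 2 [L_{ι_i(a)}, L_{e_{i+1}}]` of `J`, where `L_x` is the
multiplication by `x`. -/
def D (i : Fin 3) (a : V) : Module.End k C.J :=
  (2 : k) • superComm k C.J (C.jordanMul (C.iota i a)) (C.jordanMul (C.e (i + 1)))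

end HurwitzSuperalgebra

section Phi

variable {k : Type*} [Field k] [NeZero (2 : k)] {V : Type*} [AddCommGroup V] [Module k V]
  [Superspace k V]

/-- The one-dimensional para-Hurwitz algebra `S₁ = k1`. -/
abbrev S1 (k : Type*) [Field k] [NeZero (2 : k)] : SymmetricCompositionSuperalgebra k k :=
  (HurwitzSuperalgebra.ground k).para

/-- `D = D_{(d_0,d_1,d_2)}`: the linear map with `D(e_i) = 0` and `D(ι_i(a)) = ι_i(d_i(a))`. -/
def HurwitzSuperalgebra.IsDTri (C : HurwitzSuperalgebra k V) (d : Fin 3 → Module.End k V)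
    (D : Module.End k C.J) : Prop :=
  (∀ i, D (C.e i) = 0) ∧ ∀ i a, D (C.iota i a) = C.iota i (d i a)

/-- The linear map `Φ : 𝔤(S₁, S) → der J` has the prescribed values: `Φ(d) = D_d` for `d` in
`tri(S)`, and `Φ(ι_i(1 ⊗ a)) = D_i(a)`. -/
def HurwitzSuperalgebra.IsPhi (C : HurwitzSuperalgebra k V)
    (Φ : MagicAlgebra (S1 k) C.para →ₗ[k] Der C.jordanMul) : Prop :=
  (∀ d : C.para.tri, C.IsDTri d (Φ (MagicAlgebra.ofTri' (S1 k) C.para d))) ∧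
  ∀ i a, (Φ (MagicAlgebra.iota (S1 k) C.para i (1 ⊗ₜ[k] a)) : Module.End k C.J) = C.D i a

end Phi

end SuperMagic

end

noncomputable section

namespace SuperMagic

/-! ### Reduction to homogeneous elements -/

section General

variable {k : Type*} [Field k] {V : Type*} [AddCommGroup V] [Module k V] [Superspace k V]

/-! Relative to the idempotents e_0, e_1, e_2, the space J is the sum of the spans of the e_i and of
the pieces ι_i(C) (`decomposition`). In these coordinates the product is governed by S alone: e_m
acts on ι_n(a) by 0 if m = n and by 1/2 otherwise, ι_i(a) ∘ ι_i(b) = 2 b(a,b)(e_{i+1} + e_{i+2}),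
and ι_i(a) ∘ ι_{i+1}(b) = ι_{i+2}(a • b). This table is invariant under the cyclic shift of indices,
which is the reason for using the para-Hurwitz product.

A superderivation that kills the e_i commutes with every L_{e_m}, hence preserves each ι_i(C) and
acts on it by some d_i. The Leibniz rule on ι_i(C) ∘ ι_i(C) says that d_i is skew for b, and on
ι_1(C) ∘ ι_2(C) it is the triality relation; so these derivations are exactly the D_d with d in
tri(S) (`DTri_mem`, `exists_eq_DTri`). For an arbitrary superderivation, differentiating e_i ∘ e_i =
e_i and e_i ∘ e_j = 0 leaves in the images of the idempotents only three free elements of C, one for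
each i, and the D_i(a_i) realize them. Therefore der J consists of the sums D_d + ∑ D_i(a_i)
(`exists_eq_DTri_add_DL`), each written in one way (`DTri_add_DL_eq_zero`).

On the other side tri(S_1) = 0 and S_1 ⊗ S is a copy of S, so 𝔤(S_1, S) has the same shape tri(S) ⊕
S ⊕ S ⊕ S, and Φ is a linear bijection. For the products, the supercommutators of the D_d and D_i(a)
are evaluated on the generators of J (`superComm_DTri_DTri`, `superComm_DTri_DL`,
`superComm_DL_DL_self`, `superComm_DL_DL_succ`). The inputs are the identity (x • y) • z ± (z • y) •
x = ± b(x,z) y, its mirror image, and the associativity of b. The results match the bracket of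
𝔤(S_1, S) because 1 • 1 = 1 and b(1,1) = 2 in S_1.

The Jacobi identity of 𝔤(S_1, S) needs no computation of its own: der J is a Lie superalgebra under
the supercommutator, and this structure is pulled back along Φ (`IsSuperIso.isLieSuperalgebra`). -/

lemma gr_ext {V' : Type*} [AddCommGroup V'] [Module k V'] {f g : V →ₗ[k] V'}
    (h : ∀ i, ∀ x ∈ gr k V i, f x = g x) : f = g := by
  ext x
  refine hom_induction (k := k) h (fun x y hx hy => ?_) x
  rw [map_add, map_add, hx, hy]

/-- This and its mirror image remove the sign as soon as one factor is even. They allow computations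
with the idempotents e_i on inhomogeneous elements. -/
lemma superFlip_zero_left {W X : Type*} [AddCommGroup W] [Module k W] [Superspace k W]
    [AddCommGroup X] [Module k X] (B : V →ₗ[k] W →ₗ[k] X) {y : W} (hy : y ∈ gr k W 0) (x : V) :
    superFlip B y x = B x y := by
  refine hom_induction (k := k) (fun i x hx => ?_) (fun x x' h h' => ?_) x
  · simp [superFlip_apply B hy hx]
  · simp [h, h']

lemma superFlip_zero_right {W X : Type*} [AddCommGroup W] [Module k W] [Superspace k W]
    [AddCommGroup X] [Module k X] (B : V →ₗ[k] W →ₗ[k] X) (y : W) {x : V} (hx : x ∈ gr k V 0) :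
    superFlip B y x = B x y := by
  refine hom_induction (k := k) (fun i y hy => ?_) (fun x x' h h' => ?_) y
  · simp [superFlip_apply B hy hx]
  · simp [h, h']

end General

/-! ### Matrix units and Peirce coordinates in J -/

namespace HurwitzSuperalgebra

variable {k : Type*} [Field k] {V : Type*} [AddCommGroup V] [Module k V] [Superspace k V]
  (C : HurwitzSuperalgebra k V)

lemma matMul_single (i j j' l : Fin 3) (a b : V) :
    C.matMul (Matrix.single i j a) (Matrix.single j' l b) =
      if j = j' then Matrix.single i l (C.mul a b) else 0 := by
  ext p r
  simp only [matMul, LinearMap.mk₂_apply, Matrix.of_apply, Matrix.single_apply]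
  split_ifs with h
  · subst h
    rw [Finset.sum_eq_single j]
    · by_cases h1 : i = p <;> by_cases h2 : l = r <;> simp [Matrix.single_apply, h1, h2]
    · intro m _ hm
      simp [hm.symm]
    · simp
  · refine Finset.sum_eq_zero fun m _ => ?_
    by_cases h1 : j = m <;> by_cases h2 : j' = m <;> simp [h1, h2]
    exact absurd (h1.trans h2.symm) h

/-- The second summand is the conjugate of the first, z + z̄ = b(z,1)1 for every z, and b(x ȳ, 1) =
b(x, y). -/
lemma mul_conj_add {i j : ZMod 2} {x y : V} (hx : x ∈ gr k V i) (hy : y ∈ gr k V j) :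
    C.mul x (C.conj y) + sgn k (i * j) • C.mul y (C.conj x) = C.b x y • C.one := by
  have h := C.conj_mul hx (C.conj_mem j y hy)
  have h1 := C.b_mul_eq_right hx (C.conj_mem j y hy) C.one_mem
  simp only [conj_conj, mul_zero, sgn_zero, C.one_mul, _root_.one_mul] at h h1
  rw [← h, C.conj_apply (C.mul x (C.conj y)), h1]
  abel

lemma conj_mul_add {i j : ZMod 2} {x y : V} (hx : x ∈ gr k V i) (hy : y ∈ gr k V j) :
    C.mul (C.conj x) y + sgn k (i * j) • C.mul (C.conj y) x = C.b x y • C.one := by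
  simpa [b_conj_conj] using C.mul_conj_add (C.conj_mem i x hx) (C.conj_mem j y hy)

lemma gr_J_iff {i : ZMod 2} {A : C.J} :
    A ∈ gr k C.J i ↔ ∀ p r, C.toMatrix A p r ∈ gr k V i :=
  ⟨fun h p r => (show C.toMatrix A ∈ gr k (Matrix (Fin 3) (Fin 3) V) i from h) p trivial r trivial,
    fun h => show C.toMatrix A ∈ gr k (Matrix (Fin 3) (Fin 3) V) i from fun p _ r _ => h p r⟩

lemma gr_J_toMatrix {i : ZMod 2} {A : C.J} (hA : A ∈ gr k C.J i) :
    C.toMatrix A ∈ gr k (Matrix (Fin 3) (Fin 3) V) i := hA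

lemma toMatrix_e (i : Fin 3) : C.toMatrix (C.e i) = Matrix.single i i C.one := rfl

lemma toMatrix_iota (i : Fin 3) (a : V) : C.toMatrix (C.iota i a) =
    (2 : k) • (Matrix.single (i + 2) (i + 1) a + Matrix.single (i + 1) (i + 2) (C.conj a)) := rfl

lemma toMatrix_jordanMul (A B : C.J) :
    C.toMatrix (C.jordanMul A B) = C.symMul (C.toMatrix A) (C.toMatrix B) := rfl

lemma single_mem_gr {i : ZMod 2} {a : V} (ha : a ∈ gr k V i) (p r : Fin 3) :
    Matrix.single p r a ∈ gr k (Matrix (Fin 3) (Fin 3) V) i := by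
  intro m _ n _
  rw [Matrix.single_apply]
  split_ifs
  exacts [ha, zero_mem _]

lemma e_mem (i : Fin 3) : C.e i ∈ gr k C.J 0 :=
  show C.toMatrix (C.e i) ∈ gr k (Matrix (Fin 3) (Fin 3) V) 0 from
    single_mem_gr C.one_mem i i

lemma iota_mem (i : Fin 3) {j : ZMod 2} {a : V} (ha : a ∈ gr k V j) : C.iota i a ∈ gr k C.J j :=
  show C.toMatrix (C.iota i a) ∈ gr k (Matrix (Fin 3) (Fin 3) V) j from
    Submodule.smul_mem _ _ (add_mem (single_mem_gr ha _ _) (single_mem_gr (C.conj_mem j a ha) _ _))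

/-- The linear map `ι_i : C → J`. -/
def iotaL (i : Fin 3) : V →ₗ[k] C.J where
  toFun := C.iota i
  map_add' a b := C.toMatrix_injective <| by
    simp only [map_add, toMatrix_iota, Matrix.single_add]
    module
  map_smul' c a := C.toMatrix_injective <| by
    simp only [map_smul, toMatrix_iota, ← Matrix.smul_single, RingHom.id_apply]
    module

lemma iotaL_apply (i : Fin 3) (a : V) : C.iotaL i a = C.iota i a := rfl

lemma iotaL_mem (i : Fin 3) {j : ZMod 2} {a : V} (ha : a ∈ gr k V j) :
    C.iotaL i a ∈ gr k C.J j := C.iota_mem i ha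

/-- The coordinate `A ↦ ½ A_{i+2,i+1}`, so that `coord i (ι_i(a)) = a`. -/
def coord (i : Fin 3) : C.J →ₗ[k] V :=
  (2⁻¹ : k) • (Matrix.entryLinearMap k V (i + 2) (i + 1) ∘ₗ C.toMatrix)

/-- The coordinate of `e_i` in an element of `J`. -/
def diagCoord (i : Fin 3) : C.J →ₗ[k] k :=
  (2⁻¹ : k) • (C.b.flip C.one ∘ₗ Matrix.entryLinearMap k V i i ∘ₗ C.toMatrix)

lemma coord_mem (i : Fin 3) {j : ZMod 2} {A : C.J} (hA : A ∈ gr k C.J j) :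
    C.coord i A ∈ gr k V j :=
  Submodule.smul_mem _ _ (C.gr_J_iff.1 hA _ _)

lemma diagCoord_odd (i : Fin 3) {A : C.J} (hA : A ∈ gr k C.J 1) : C.diagCoord i A = 0 := by
  have := C.b_even 1 0 _ (C.gr_J_iff.1 hA i i) _ C.one_mem (by simp)
  simp [diagCoord, this]

lemma coord_e (i j : Fin 3) : C.coord i (C.e j) = 0 := by
  have : ∀ i j : Fin 3, ¬ (j = i + 2 ∧ j = i + 1) := by decide
  simp [coord, toMatrix_e, Matrix.single_apply, this]

/-! ### The multiplication table of `J` -/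

lemma toMatrix_jordanMul_apply {i j : ZMod 2} {A B : C.J} (hA : A ∈ gr k C.J i)
    (hB : B ∈ gr k C.J j) : C.toMatrix (C.jordanMul A B) =
      (2⁻¹ : k) • (C.matMul (C.toMatrix A) (C.toMatrix B) +
        sgn k (i * j) • C.matMul (C.toMatrix B) (C.toMatrix A)) := by
  rw [toMatrix_jordanMul, symMul, LinearMap.smul_apply, LinearMap.smul_apply,
    LinearMap.add_apply, LinearMap.add_apply,
    superFlip_apply _ (C.gr_J_toMatrix hA) (C.gr_J_toMatrix hB)]

lemma toMatrix_jordanMul_even {A : C.J} (hA : A ∈ gr k C.J 0) (B : C.J) :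
    C.toMatrix (C.jordanMul A B) = (2⁻¹ : k) • (C.matMul (C.toMatrix A) (C.toMatrix B) +
      C.matMul (C.toMatrix B) (C.toMatrix A)) := by
  rw [toMatrix_jordanMul, symMul, LinearMap.smul_apply, LinearMap.smul_apply,
    LinearMap.add_apply, LinearMap.add_apply, superFlip_zero_left _ (C.gr_J_toMatrix hA)]

lemma jordanMul_comm {i j : ZMod 2} {A B : C.J} (hA : A ∈ gr k C.J i) (hB : B ∈ gr k C.J j) :
    C.jordanMul A B = sgn k (i * j) • C.jordanMul B A := by
  refine C.toMatrix_injective ?_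
  rw [map_smul, C.toMatrix_jordanMul_apply hA hB, C.toMatrix_jordanMul_apply hB hA]
  rcases parity_cases i with rfl | rfl <;> rcases parity_cases j with rfl | rfl <;> simp [add_comm]

lemma jordanMul_mem {i j : ZMod 2} {A B : C.J} (hA : A ∈ gr k C.J i) (hB : B ∈ gr k C.J j) :
    C.jordanMul A B ∈ gr k C.J (i + j) := by
  have hm : ∀ A B : C.J, ∀ i j, (∀ p r, C.toMatrix A p r ∈ gr k V i) →
      (∀ p r, C.toMatrix B p r ∈ gr k V j) →
      ∀ p r, C.matMul (C.toMatrix A) (C.toMatrix B) p r ∈ gr k V (i + j) :=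
    fun A B i j hA hB p r => by
      simp only [matMul, LinearMap.mk₂_apply, Matrix.of_apply]
      exact Submodule.sum_mem _ fun l _ => C.mul_mem _ _ _ (hA p l) _ (hB l r)
  rw [gr_J_iff]
  intro p r
  rw [C.toMatrix_jordanMul_apply hA hB]
  rw [gr_J_iff] at hA hB
  exact Submodule.smul_mem _ _ (add_mem (hm A B i j hA hB p r)
    (Submodule.smul_mem _ _ (add_comm i j ▸ hm B A j i hB hA p r)))

variable [NeZero (2 : k)]

lemma inv_two_mul : (2 : k)⁻¹ * 2 = 1 := inv_mul_cancel₀ (NeZero.ne _)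

lemma coord_iota (i j : Fin 3) (a : V) : C.coord i (C.iotaL j a) = if i = j then a else 0 := by
  have h2 : ∀ i j : Fin 3, ¬ (j + 1 = i + 2 ∧ j + 2 = i + 1) := by decide
  simp [iotaL_apply, coord, toMatrix_iota, Matrix.single_apply, h2, smul_smul, inv_two_mul,
    eq_comm (a := i)]

lemma decomposition (A : C.J) :
    A = ∑ i, C.diagCoord i A • C.e i + ∑ i, C.iotaL i (C.coord i A) := by
  refine C.toMatrix_injective ?_
  have h := C.toMatrix_mem A
  -- A diagonal entry a of a hermitian matrix satisfies ā = a, that is 2a = b(a,1)1. So it is a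
  -- multiple of 1 once 2 is invertible.
  have hd : ∀ p, (2⁻¹ * C.b (C.toMatrix A p p) C.one) • C.one = C.toMatrix A p p := by
    intro p
    have hp := h p p
    rw [conj_apply, eq_sub_iff_add_eq, ← two_smul k] at hp
    rw [mul_smul, ← hp, smul_smul, inv_two_mul, one_smul]
  have ho : ∀ x : V, (2⁻¹ : k) • (2 : k) • x = x := fun x => by
    rw [smul_smul, inv_two_mul, one_smul]
  have hc : ∀ p r, C.conj (C.toMatrix A p r) = C.toMatrix A r p := fun p r => (h r p).symm
  ext p r
  simp only [map_add, map_smul, Fin.sum_univ_three, iotaL_apply, toMatrix_e,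
    toMatrix_iota, Matrix.add_apply, Matrix.smul_apply, coord, diagCoord, LinearMap.smul_apply,
    LinearMap.comp_apply, LinearMap.flip_apply, Matrix.entryLinearMap_apply, smul_eq_mul, hc]
  fin_cases p <;> fin_cases r <;> simp [hd, ho]

-- The idempotents have to be treated only in the even case: the diagonal of an odd element
-- vanishes, its entries being multiples of the even element 1.
@[elab_as_elim]
lemma J_induction {P : C.J → Prop} {j : ZMod 2} (zero : P 0)
    (add : ∀ A B, P A → P B → P (A + B)) (smul : ∀ (c : k) A, P A → P (c • A))
    (he : j = 0 → ∀ i, P (C.e i)) (hi : ∀ i, ∀ a ∈ gr k V j, P (C.iotaL i a))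
    (A : C.J) (hA : A ∈ gr k C.J j) : P A := by
  have hs : ∀ f : Fin 3 → C.J, (∀ i, P (f i)) → P (∑ i, f i) := fun f hf => by
    rw [Fin.sum_univ_three]
    exact add _ _ (add _ _ (hf 0) (hf 1)) (hf 2)
  rw [C.decomposition A]
  refine add _ _ (hs _ fun i => ?_) (hs _ fun i => hi i _ (C.coord_mem i hA))
  rcases parity_cases j with rfl | rfl
  · exact smul _ _ (he rfl i)
  · rw [C.diagCoord_odd i hA, zero_smul]
    exact zero

lemma J_ext {M : Type*} [AddCommGroup M] [Module k M] {f g : C.J →ₗ[k] M}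
    (he : ∀ i, f (C.e i) = g (C.e i))
    (hi : ∀ i j, ∀ a ∈ gr k V j, f (C.iotaL i a) = g (C.iotaL i a)) : f = g := by
  refine gr_ext fun j A hA => ?_
  refine C.J_induction (by simp) (fun A B h h' => by simp [h, h'])
    (fun c A h => by simp [h]) (fun _ => he) (fun i a ha => hi i j a ha) A hA

lemma iotaL_injective (i : Fin 3) : Function.Injective (C.iotaL i) := fun a b h => by
  simpa [coord_iota] using congrArg (C.coord i) h

lemma e_mul_e (m n : Fin 3) :
    C.jordanMul (C.e m) (C.e n) = if m = n then C.e m else 0 := by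
  refine C.toMatrix_injective ?_
  simp only [C.toMatrix_jordanMul_even (C.e_mem m), toMatrix_e, matMul_single, C.one_mul]
  by_cases h : m = n
  · subst h
    simp only [if_true, toMatrix_e, ← two_smul k, smul_smul, inv_two_mul, one_smul]
  · simp [h, Ne.symm h]

omit [NeZero (2 : k)] in
lemma e_mul_iota (m n : Fin 3) (a : V) :
    C.jordanMul (C.e m) (C.iotaL n a) = if m = n then 0 else (2⁻¹ : k) • C.iotaL n a := by
  refine C.toMatrix_injective ?_
  simp only [iotaL_apply, C.toMatrix_jordanMul_even (C.e_mem m), toMatrix_e, toMatrix_iota,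
    map_add, map_smul, LinearMap.add_apply, LinearMap.smul_apply, matMul_single, C.one_mul,
    C.mul_one]
  fin_cases m <;> fin_cases n <;> simp [toMatrix_iota, add_comm]

lemma iota_mul_e (m n : Fin 3) (a : V) :
    C.jordanMul (C.iotaL n a) (C.e m) = if m = n then 0 else (2⁻¹ : k) • C.iotaL n a := by
  rw [← e_mul_iota]
  refine hom_induction (k := k) (fun i x hx => ?_) (fun x x' h h' => ?_) a
  · simp [C.jordanMul_comm (C.iotaL_mem n hx) (C.e_mem m)]
  · simp [h, h']

lemma iota_mul_iota_self (i : Fin 3) (a b : V) :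
    C.jordanMul (C.iotaL i a) (C.iotaL i b) = (2 * C.b a b) • (C.e (i + 1) + C.e (i + 2)) := by
  refine hom_induction (k := k) (fun p a ha => ?_) (fun x x' h h' => ?_) a
  · refine hom_induction (k := k) (fun r b hb => ?_) (fun x x' h h' => ?_) b
    · refine C.toMatrix_injective ?_
      simp only [iotaL_apply, C.toMatrix_jordanMul_apply (C.iota_mem i ha) (C.iota_mem i hb),
        toMatrix_e, toMatrix_iota, map_add, map_smul, LinearMap.add_apply, LinearMap.smul_apply,
        matMul_single]
      have hn : ∀ i : Fin 3, i + 1 ≠ i + 2 := by decide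
      simp only [hn, (hn i).symm, if_true, if_false]
      rw [mul_smul, smul_add (C.b a b), Matrix.smul_single, Matrix.smul_single,
        ← C.conj_mul_add ha hb]
      -- The preceding rewrite affects both diagonal entries. The one at (i+1, i+1) is indeed built
      -- from ā b, but the one at (i+2, i+2) comes from a b̄ and is switched to the other expression
      -- for b(a,b)1.
      conv_rhs => arg 2; arg 2; rw [C.conj_mul_add ha hb, ← C.mul_conj_add ha hb]
      simp only [Matrix.single_add, ← Matrix.smul_single]
      match_scalars <;>
        first
        | linear_combination 2 * inv_two_mul (k := k)
        | linear_combination (2 * sgn k (p * r)) * inv_two_mul (k := k)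
    · simp only [map_add, h, h']; module
  · simp only [map_add, LinearMap.add_apply, h, h']; module

/-- The entries ā at (i+1, i+2) and b̄ at (i+2, i) multiply to ā b̄ at (i+1, i), which is the
leading position of ι_{i+2}; this is where x̄ ȳ enters. The opposite entry is b a up to sign, the
conjugate of ā b̄. The factor 2 in the definition of ι_i absorbs the 1/2 of the Jordan product. -/
lemma iota_mul_iota_succ (i : Fin 3) (a b : V) :
    C.jordanMul (C.iotaL i a) (C.iotaL (i + 1) b) = C.iotaL (i + 2) (C.para.mul a b) := by
  refine hom_induction (k := k) (fun p a ha => ?_) (fun x x' h h' => ?_) a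
  · refine hom_induction (k := k) (fun r b hb => ?_) (fun x x' h h' => ?_) b
    · refine C.toMatrix_injective ?_
      have hc := C.conj_mul (C.conj_mem _ _ ha) (C.conj_mem _ _ hb)
      rw [conj_conj, conj_conj] at hc
      have hp : C.para.mul a b = C.mul (C.conj a) (C.conj b) := rfl
      simp only [iotaL_apply, C.toMatrix_jordanMul_apply (C.iota_mem i ha) (C.iota_mem (i + 1) hb),
        toMatrix_iota, map_add, map_smul, LinearMap.add_apply, LinearMap.smul_apply,
        matMul_single, hp, hc]
      have h0 : i + 1 + 2 = i := by fin_cases i <;> rfl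
      have h1 : i + 1 + 1 = i + 2 := by fin_cases i <;> rfl
      have h2 : i + 2 + 2 = i + 1 := by fin_cases i <;> rfl
      have h3 : i + 2 + 1 = i := by fin_cases i <;> rfl
      have n1 : i + 1 ≠ i := by fin_cases i <;> decide
      have n2 : i + 2 ≠ i := by fin_cases i <;> decide
      have n3 : i + 1 ≠ i + 2 := by fin_cases i <;> decide
      simp only [h0, h1, h2, h3, n1, n2, n3, n1.symm, n2.symm, n3.symm, if_true, if_false,
        ← Matrix.smul_single]
      match_scalars
      · linear_combination 2 * inv_two_mul (k := k)
      · linear_combination (2 * sgn k (p * r)) * inv_two_mul (k := k)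
    · simp only [map_add, h, h']
  · simp only [map_add, LinearMap.add_apply, h, h']

lemma iota_mul_iota_pred {p r : ZMod 2} (i : Fin 3) {a b : V} (ha : a ∈ gr k V p)
    (hb : b ∈ gr k V r) : C.jordanMul (C.iotaL (i + 1) a) (C.iotaL i b) =
      sgn k (p * r) • C.iotaL (i + 2) (C.para.mul b a) := by
  rw [C.jordanMul_comm (C.iotaL_mem _ ha) (C.iotaL_mem _ hb), iota_mul_iota_succ]

end HurwitzSuperalgebra

/-! ### Cyclic indices and the Leibniz rule on generators of J -/

section General

variable {k : Type*} [Field k] {V : Type*} [AddCommGroup V] [Module k V] [Superspace k V]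

lemma superComm_apply_even_right (f : Module.End k V) {g : Module.End k V}
    (hg : g ∈ gr k (Module.End k V) 0) (x : V) :
    superComm k V f g x = f (g x) - g (f x) := by
  simp [superComm, superSkew, superFlip_zero_right _ f hg]

lemma fin_three_cases (i m : Fin 3) : i = m ∨ m = i + 1 ∨ m = i + 2 := by
  revert i m; decide

lemma fin_three_add_one_one (i : Fin 3) : i + 1 + 1 = i + 2 := by revert i; decide
lemma fin_three_add_one_two (i : Fin 3) : i + 1 + 2 = i := by revert i; decide
lemma fin_three_add_two_one (i : Fin 3) : i + 2 + 1 = i := by revert i; decide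
lemma fin_three_add_two_two (i : Fin 3) : i + 2 + 2 = i + 1 := by revert i; decide

end General

namespace HurwitzSuperalgebra

variable {k : Type*} [Field k] {V : Type*} [AddCommGroup V] [Module k V] [Superspace k V]
  (C : HurwitzSuperalgebra k V) [NeZero (2 : k)]

omit [NeZero (2 : k)] in
lemma jordanMul_mem_end {i : ZMod 2} {A : C.J} (hA : A ∈ gr k C.J i) :
    C.jordanMul A ∈ gr k (Module.End k C.J) i := fun _ _ hB => C.jordanMul_mem hA hB

-- Since J is supercommutative, the Leibniz rule for one order of the factors implies it for the
-- other, which nearly halves the list of products to be checked.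
omit [NeZero (2 : k)] in
lemma leibniz_symm {p j l : ZMod 2} {D : Module.End k C.J} (hD : D ∈ gr k (Module.End k C.J) p)
    {A B : C.J} (hA : A ∈ gr k C.J j) (hB : B ∈ gr k C.J l)
    (h : D (C.jordanMul A B) =
      C.jordanMul (D A) B + sgn k (p * j) • C.jordanMul A (D B)) :
    D (C.jordanMul B A) = C.jordanMul (D B) A + sgn k (p * l) • C.jordanMul B (D A) := by
  rw [C.jordanMul_comm hB hA, map_smul, h, C.jordanMul_comm (hD _ _ hA) hB,
    C.jordanMul_comm hA (hD _ _ hB)]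
  rcases parity_cases p with rfl | rfl <;> rcases parity_cases j with rfl | rfl <;>
    rcases parity_cases l with rfl | rfl <;> simp <;> abel

/-- A linear endomorphism of `J` is a superderivation if it satisfies the Leibniz rule on the
generators `e_m` and `ι_n(a)`, up to the supercommutativity of the product. -/
lemma mem_derPart_of_generators {p : ZMod 2} {D : Module.End k C.J}
    (hD : D ∈ gr k (Module.End k C.J) p)
    (hee : ∀ m n, D (C.jordanMul (C.e m) (C.e n)) =
      C.jordanMul (D (C.e m)) (C.e n) + C.jordanMul (C.e m) (D (C.e n)))
    (hei : ∀ m n, ∀ j, ∀ a ∈ gr k V j, D (C.jordanMul (C.e m) (C.iotaL n a)) =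
      C.jordanMul (D (C.e m)) (C.iotaL n a) + C.jordanMul (C.e m) (D (C.iotaL n a)))
    (hii : ∀ n, ∀ j, ∀ a ∈ gr k V j, ∀ l, ∀ b ∈ gr k V l,
      D (C.jordanMul (C.iotaL n a) (C.iotaL n b)) = C.jordanMul (D (C.iotaL n a)) (C.iotaL n b) +
        sgn k (p * j) • C.jordanMul (C.iotaL n a) (D (C.iotaL n b)))
    (his : ∀ n, ∀ j, ∀ a ∈ gr k V j, ∀ l, ∀ b ∈ gr k V l,
      D (C.jordanMul (C.iotaL n a) (C.iotaL (n + 1) b)) =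
        C.jordanMul (D (C.iotaL n a)) (C.iotaL (n + 1) b) +
        sgn k (p * j) • C.jordanMul (C.iotaL n a) (D (C.iotaL (n + 1) b))) :
    D ∈ derPart C.jordanMul p := by
  refine ⟨hD, fun j A hA B => ?_⟩
  refine hom_induction (k := k) (fun l B hB => ?_)
    (fun B B' h h' => by simp only [map_add, h, h']; module) B
  refine C.J_induction (by simp)
    (fun B B' h h' => by simp only [map_add, h, h']; module)
    (fun c B h => by simp only [map_smul, h]; module) ?_ ?_ B hB
  · rintro rfl n
    refine C.J_induction (by simp)
      (fun B B' h h' => by simp only [map_add, LinearMap.add_apply, h, h']; module)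
      (fun c B h => by simp only [map_smul, LinearMap.smul_apply, h]; module) ?_ ?_ A hA
    · rintro rfl m
      simpa using hee m n
    · intro m a ha
      exact C.leibniz_symm hD (C.e_mem n) (C.iotaL_mem m ha) (by simpa using hei n m j a ha)
  · intro n b hb
    refine C.J_induction (by simp)
      (fun B B' h h' => by simp only [map_add, LinearMap.add_apply, h, h']; module)
      (fun c B h => by simp only [map_smul, LinearMap.smul_apply, h]; module) ?_ ?_ A hA
    · rintro rfl m
      simpa using hei m n l b hb
    · intro m a ha
      rcases fin_three_cases m n with rfl | rfl | rfl
      · exact hii _ j a ha l b hb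
      · exact his m j a ha l b hb
      -- Here the indices are m and m+2. In the reversed order they are consecutive, because m+2+1 =
      -- m.
      · refine C.leibniz_symm hD (C.iotaL_mem _ hb) (C.iotaL_mem _ ha) ?_
        have := his (m + 2) l b hb j a ha
        rwa [fin_three_add_two_one] at this

/-! ### The derivations `D_d` -/

/-- The endomorphism `D_d` of `J`, with `D_d(e_i) = 0` and `D_d(ι_i(a)) = ι_i(d_i(a))`. -/
def DTri : (Fin 3 → Module.End k V) →ₗ[k] Module.End k C.J where
  toFun d := ∑ i, C.iotaL i ∘ₗ d i ∘ₗ C.coord i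
  map_add' d f := by
    ext1 A
    simp [Finset.sum_add_distrib]
  map_smul' c d := by
    ext1 A
    simp [Finset.smul_sum]

omit [NeZero (2 : k)] in
lemma DTri_apply (d : Fin 3 → Module.End k V) (A : C.J) :
    C.DTri d A = ∑ i, C.iotaL i (d i (C.coord i A)) := by
  simp [DTri]

@[simp] lemma DTri_e (d : Fin 3 → Module.End k V) (i : Fin 3) : C.DTri d (C.e i) = 0 := by
  simp [DTri_apply, coord_e]

@[simp] lemma DTri_iota (d : Fin 3 → Module.End k V) (i : Fin 3) (a : V) :
    C.DTri d (C.iotaL i a) = C.iotaL i (d i a) := by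
  rw [DTri_apply, Finset.sum_eq_single i]
  · simp [coord_iota]
  · intro j _ hj
    simp [coord_iota, hj]
  · simp

lemma DTri_mem_end {p : ZMod 2} {d : Fin 3 → Module.End k V}
    (hd : ∀ m, d m ∈ gr k (Module.End k V) p) : C.DTri d ∈ gr k (Module.End k C.J) p := by
  intro j A hA
  rw [DTri_apply]
  exact Submodule.sum_mem _ fun i _ => C.iotaL_mem i (hd i _ _ (C.coord_mem i hA))

-- The relation that defines tri(S) is the case n = 1. The other two are its cyclic rotations,
-- available because b is associative for the product of S (`rot_mem`).
omit [NeZero (2 : k)] in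
lemma triPart_rot (S : SymmetricCompositionSuperalgebra k V) {p : ZMod 2}
    {d : Fin 3 → Module.End k V} (hd : d ∈ S.triPart p) (n : Fin 3) {j : ZMod 2} {x : V}
    (hx : x ∈ gr k V j) (y : V) :
    d (n + 2) (S.mul x y) = S.mul (d n x) y + sgn k (p * j) • S.mul x (d (n + 1) y) := by
  have h1 := S.rot_mem hd
  have h2 := S.rot_mem h1
  fin_cases n
  · exact h2.2 j x hx y
  · exact hd.2 j x hx y
  · exact h1.2 j x hx y

/-- The multiplication table translates the Leibniz rule into the definition of tri(S): products
inside one ι_n(C) require that d_n be skew for b, products of consecutive pieces are the rotated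
triality relations, and products with the e_m impose nothing. -/
lemma DTri_mem {p : ZMod 2} {d : Fin 3 → Module.End k V} (hd : d ∈ C.para.triPart p) :
    C.DTri d ∈ derPart C.jordanMul p := by
  refine C.mem_derPart_of_generators (C.DTri_mem_end fun m => (hd.1 m).1) ?_ ?_ ?_ ?_
  · intro m n
    rw [e_mul_e]
    split_ifs <;> simp
  · intro m n j a ha
    simp only [DTri_e, DTri_iota, e_mul_iota]
    split_ifs <;> simp
  · intro n j a ha l b hb
    have h := (hd.1 n).2 j a ha b
    -- The forms of C and of `C.para` agree by definition, but not syntactically.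
    change C.b _ _ + _ * C.b _ _ = 0 at h
    simp only [DTri_iota, iota_mul_iota_self, map_smul, map_add, DTri_e]
    linear_combination (norm := module) (-2 * h) • (C.e (n + 1) + C.e (n + 2))
  · intro n j a ha l b hb
    simp only [DTri_iota, iota_mul_iota_succ, triPart_rot C.para hd n ha, map_add, map_smul]

/-! ### The derivations `D_i(a)` -/

lemma D_apply (i : Fin 3) (a : V) (A : C.J) : C.D i a A =
    (2 : k) • (C.jordanMul (C.iotaL i a) (C.jordanMul (C.e (i + 1)) A) -
      C.jordanMul (C.e (i + 1)) (C.jordanMul (C.iotaL i a) A)) := by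
  rw [D, LinearMap.smul_apply,
    superComm_apply_even_right _ (C.jordanMul_mem_end (C.e_mem (i + 1)))]
  rfl

lemma D_mem_end {p : ZMod 2} (i : Fin 3) {a : V} (ha : a ∈ gr k V p) :
    C.D i a ∈ gr k (Module.End k C.J) p := by
  have := superComm_mem (C.jordanMul_mem_end (C.iota_mem i ha))
    (C.jordanMul_mem_end (C.e_mem (i + 1)))
  rw [add_zero] at this
  exact Submodule.smul_mem _ _ this

/-- The linear map `a ↦ D_i(a)`. -/
def DL (i : Fin 3) : V →ₗ[k] Module.End k C.J where
  toFun := C.D i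
  map_add' a b := by
    ext1 A
    simp only [D_apply, map_add, LinearMap.add_apply]
    module
  map_smul' c a := by
    ext1 A
    simp only [D_apply, map_smul, LinearMap.smul_apply, RingHom.id_apply]
    module

lemma DL_apply (i : Fin 3) (a : V) : C.DL i a = C.D i a := rfl

-- The values of D_i(a) on the generators all follow from one rule. Every e_m and every ι_n(b) is an
-- eigenvector of L_{e_{i+1}}, with eigenvalue 0, 1/2 or 1. So D_i(a) is multiplication by ι_i(a),
-- where each component of the result is scaled by twice the eigenvalue of the source minus that of
-- the target. This factor is 1 or -1 whenever the component is nonzero.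
@[simp] lemma DL_e_self (i : Fin 3) (a : V) : C.DL i a (C.e i) = 0 := by
  simp [DL_apply, D_apply, e_mul_e, iota_mul_e]

@[simp] lemma DL_e_add_one (i : Fin 3) (a : V) :
    C.DL i a (C.e (i + 1)) = (2⁻¹ : k) • C.iotaL i a := by
  simp only [DL_apply, D_apply, e_mul_e, iota_mul_e, e_mul_iota, map_smul, add_eq_left,
    one_ne_zero, if_true, if_false]
  match_scalars
  linear_combination (-(2⁻¹ : k)) * inv_two_mul (k := k)

@[simp] lemma DL_e_add_two (i : Fin 3) (a : V) :
    C.DL i a (C.e (i + 2)) = -((2⁻¹ : k) • C.iotaL i a) := by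
  have h : i + 1 ≠ i + 2 := by simp
  have h' : i + 2 ≠ i := by simp
  simp only [DL_apply, D_apply, e_mul_e, iota_mul_e, e_mul_iota, map_smul, map_zero, h, h',
    add_eq_left, one_ne_zero, if_false]
  match_scalars
  linear_combination (-(2⁻¹ : k)) * inv_two_mul (k := k)

@[simp] lemma DL_iota_self (i : Fin 3) (a b : V) :
    C.DL i a (C.iotaL i b) = (2 * C.b a b) • (C.e (i + 2) - C.e (i + 1)) := by
  have h : i + 1 ≠ i + 2 := by simp
  simp only [DL_apply, D_apply, iota_mul_iota_self, e_mul_iota, e_mul_e, map_smul, map_add, h,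
    add_eq_left, one_ne_zero, if_false, if_true]
  match_scalars <;> linear_combination (2 * C.b a b) * inv_two_mul (k := k)

@[simp] lemma DL_iota_add_one (i : Fin 3) (a b : V) :
    C.DL i a (C.iotaL (i + 1) b) = -C.iotaL (i + 2) (C.para.mul a b) := by
  have h : i + 1 ≠ i + 2 := by simp
  simp only [DL_apply, D_apply, iota_mul_iota_succ, e_mul_iota, map_zero, h, if_false, if_true]
  match_scalars
  linear_combination -inv_two_mul (k := k)

/-- The product ι_i(a) ∘ ι_{i+2}(b) is taken against the cyclic order, so the factors are
interchanged; hence the sign and the homogeneity assumptions. -/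
lemma DL_iota_add_two {p r : ZMod 2} (i : Fin 3) {a b : V} (ha : a ∈ gr k V p)
    (hb : b ∈ gr k V r) : C.DL i a (C.iotaL (i + 2) b) =
      sgn k (p * r) • C.iotaL (i + 1) (C.para.mul b a) := by
  have h : i + 1 ≠ i + 2 := by simp
  have hm := C.iota_mul_iota_pred (i + 2) ha hb
  rw [fin_three_add_two_one, fin_three_add_two_two] at hm
  simp only [DL_apply, D_apply, hm, e_mul_iota, map_smul, h, if_false, if_true]
  match_scalars
  linear_combination sgn k (p * r) * inv_two_mul (k := k)

/-- For n = i both sides vanish, since e_{i+1} and e_{i+2} act equally on ι_i(C) and D_i(a) takes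
opposite values on them. For n = i+1 the rule is the composition identity for b • (a • c), and for n
= i+2 it is the one for (b • a) • c. -/
lemma DL_leibniz_self {p j l : ZMod 2} (i n : Fin 3) {a b c : V} (ha : a ∈ gr k V p)
    (hb : b ∈ gr k V j) (hc : c ∈ gr k V l) :
    C.DL i a (C.jordanMul (C.iotaL n b) (C.iotaL n c)) =
      C.jordanMul (C.DL i a (C.iotaL n b)) (C.iotaL n c) +
        sgn k (p * j) • C.jordanMul (C.iotaL n b) (C.DL i a (C.iotaL n c)) := by
  have ht := inv_two_mul (k := k)
  rcases fin_three_cases i n with rfl | rfl | rfl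
  · simp [iota_mul_iota_self, e_mul_iota, iota_mul_e]
  · have h1 := C.iota_mul_iota_pred (i + 1) (C.para.mul_mem _ _ _ ha _ hb) hc
    have h2 := C.iota_mul_iota_succ (i + 1) b (C.para.mul a c)
    have h3 := congrArg (C.iotaL i) (C.para.mul_mul_right hb ha hc)
    rw [fin_three_add_one_one, fin_three_add_one_two] at h1 h2
    simp only [iota_mul_iota_self, map_smul, map_add, DL_iota_add_one, fin_three_add_one_one,
      fin_three_add_one_two, DL_e_self, DL_e_add_two, map_neg, LinearMap.neg_apply, h1, h2]
      at h3 ⊢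
    change _ = (_ * C.b b c) • _ at h3
    linear_combination (norm := skip) (sgn k (p * j)) • h3
    rcases parity_cases p with rfl | rfl <;> rcases parity_cases j with rfl | rfl <;>
      rcases parity_cases l with rfl | rfl <;> simp <;> match_scalars <;> grind
  · have h1 := C.iota_mul_iota_succ (i + 1) (C.para.mul b a) c
    have h2 := C.iota_mul_iota_pred (i + 1) hb (C.para.mul_mem _ _ _ hc _ ha)
    have h3 := congrArg (C.iotaL i) (C.para.mul_mul_left hb ha hc)
    rw [fin_three_add_one_one, fin_three_add_one_two] at h1 h2
    simp only [iota_mul_iota_self, map_smul, map_add, C.DL_iota_add_two i ha hb,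
      C.DL_iota_add_two i ha hc, fin_three_add_two_one, LinearMap.smul_apply,
      fin_three_add_two_two, DL_e_self, DL_e_add_one, h1, h2]
      at h3 ⊢
    change _ = (_ * C.b b c) • _ at h3
    linear_combination (norm := skip) (-sgn k (p * j)) • h3
    -- The two sides differ by the sign (-1)^{p(j+l)} in front of b(b,c), which is harmless because
    -- b(b,c) = 0 when j ≠ l.
    have h4 := C.b_even _ _ b hb c hc
    rcases parity_cases p with rfl | rfl <;> rcases parity_cases j with rfl | rfl <;>
      rcases parity_cases l with rfl | rfl <;> simp at h4 ⊢ <;> match_scalars <;> grind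

/-- For n = i and n = i+2 this is again one of the two composition identities. For n = i+1 all terms
lie on the diagonal: the coefficients are b(a • b, c), b(a, b • c) and b(b, c • a), equal up to sign
by the associativity and supersymmetry of b, and the e_i terms cancel. -/
lemma DL_leibniz_succ {p j l : ZMod 2} (i n : Fin 3) {a b c : V} (ha : a ∈ gr k V p)
    (hb : b ∈ gr k V j) (hc : c ∈ gr k V l) :
    C.DL i a (C.jordanMul (C.iotaL n b) (C.iotaL (n + 1) c)) =
      C.jordanMul (C.DL i a (C.iotaL n b)) (C.iotaL (n + 1) c) +
        sgn k (p * j) • C.jordanMul (C.iotaL n b) (C.DL i a (C.iotaL (n + 1) c)) := by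
  have n3 : i + 1 ≠ i + 2 := by simp
  have ht := inv_two_mul (k := k)
  rcases fin_three_cases i n with rfl | rfl | rfl
  · have h2 := C.iota_mul_iota_pred (i + 2) hb (C.para.mul_mem _ _ _ ha _ hc)
    have h3 := congrArg (C.iotaL (i + 1)) (C.para.mul_mul_left ha hc hb)
    rw [fin_three_add_two_one, fin_three_add_two_two] at h2
    simp only [iota_mul_iota_succ, DL_iota_self, DL_iota_add_one, map_smul, map_add, map_sub,
      C.DL_iota_add_two i ha (C.para.mul_mem _ _ _ hb _ hc), map_neg, LinearMap.smul_apply,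
      LinearMap.sub_apply, e_mul_iota, n3.symm, if_true, if_false, h2] at h3 ⊢
    change _ = (_ * C.b a b) • _ at h3
    linear_combination (norm := skip) (sgn k (j * l)) • h3
    rcases parity_cases p with rfl | rfl <;> rcases parity_cases j with rfl | rfl <;>
      rcases parity_cases l with rfl | rfl <;> simp <;> match_scalars <;> grind
  · have h1 := C.iota_mul_iota_succ (i + 1) b c
    have h4 := C.para.assoc a b c
    have h5 := C.para.assoc b c a
    have h6 := C.para.b_symm _ _ _ ha _ (C.para.mul_mem _ _ _ hb _ hc)
    change C.b _ _ = C.b _ _ at h4 h5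
    change C.b _ _ = _ * C.b _ _ at h6
    rw [fin_three_add_one_one, fin_three_add_one_two] at h1
    rw [fin_three_add_one_one]
    simp only [h1, DL_iota_self, DL_iota_add_one, C.DL_iota_add_two i ha hc, map_smul, map_neg,
      LinearMap.neg_apply, iota_mul_iota_self, fin_three_add_two_one, fin_three_add_two_two,
      fin_three_add_one_one, fin_three_add_one_two, h4, ← h5, h6]
    rcases parity_cases p with rfl | rfl <;> rcases parity_cases j with rfl | rfl <;>
      rcases parity_cases l with rfl | rfl <;> simp <;> module
  · have h1 := C.iota_mul_iota_succ (i + 2) b c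
    have h2 := C.iota_mul_iota_pred i (C.para.mul_mem _ _ _ hb _ ha) hc
    have h3 := congrArg (C.iotaL (i + 2)) (C.para.mul_mul_right ha hb hc)
    rw [fin_three_add_two_one, fin_three_add_two_two] at h1
    rw [fin_three_add_two_one]
    simp only [h1, h2, DL_iota_self, DL_iota_add_one, C.DL_iota_add_two i ha hb, map_smul,
      map_add, map_sub, LinearMap.smul_apply, iota_mul_e, n3, if_true, if_false] at h3 ⊢
    change _ = (_ * C.b a c) • _ at h3
    linear_combination (norm := skip) (-1 : k) • h3
    rcases parity_cases p with rfl | rfl <;> rcases parity_cases j with rfl | rfl <;>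
      rcases parity_cases l with rfl | rfl <;> simp <;> match_scalars <;> grind

/-- In any Jordan superalgebra [L_x, L_y] is a superderivation, but the Jordan identity of J is not
used here: the Leibniz rule is read off the values on generators. -/
lemma DL_mem {p : ZMod 2} (i : Fin 3) {a : V} (ha : a ∈ gr k V p) :
    C.DL i a ∈ derPart C.jordanMul p := by
  have n1 : i + 1 ≠ i := by simp
  have n2 : i + 2 ≠ i := by simp
  have n3 : i + 1 ≠ i + 2 := by simp
  have ht := inv_two_mul (k := k)
  refine C.mem_derPart_of_generators (C.D_mem_end i ha) ?_ ?_ ?_ ?_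
  · intro m n
    rcases fin_three_cases i m with rfl | rfl | rfl <;>
      rcases fin_three_cases i n with rfl | rfl | rfl <;>
      simp [e_mul_e, iota_mul_e, e_mul_iota, n1, n2, n3, n1.symm, n2.symm, n3.symm] <;>
      match_scalars <;> grind
  · intro m n j b hb
    rcases fin_three_cases i n with rfl | rfl | rfl
    · rcases fin_three_cases i m with rfl | rfl | rfl <;>
      simp [e_mul_e, iota_mul_iota_self, e_mul_iota, n1, n2, n3, n1.symm, n2.symm, n3.symm] <;>
      match_scalars <;> grind
    · rcases fin_three_cases i m with rfl | rfl | rfl <;>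
      simp [iota_mul_iota_succ, e_mul_iota, n3, n1.symm, n2.symm, n3.symm]
    · have hm := C.iota_mul_iota_pred (i + 2) ha hb
      rw [fin_three_add_two_one, fin_three_add_two_two] at hm
      rcases fin_three_cases i m with rfl | rfl | rfl <;>
      simp [hm, C.DL_iota_add_two i ha hb, e_mul_iota, n3, n1.symm, n2.symm, n3.symm,
        smul_comm (2⁻¹ : k)]
  · exact fun n j b hb l c hc => C.DL_leibniz_self i n ha hb hc
  · exact fun n j b hb l c hc => C.DL_leibniz_succ i n ha hb hc

end HurwitzSuperalgebra

/-! ### Lie superalgebras of superderivations, and transport of structure -/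

section General

variable {k : Type*} [Field k] {V : Type*} [AddCommGroup V] [Module k V] [Superspace k V]

lemma derBracket_coe (p : V →ₗ[k] V →ₗ[k] V) (x y : Der p) :
    (derBracket p x y : Module.End k V) = superComm k V x y := rfl

lemma superComm_skew {i j : ZMod 2} {f g : Module.End k V} (hf : f ∈ gr k (Module.End k V) i)
    (hg : g ∈ gr k (Module.End k V) j) :
    superComm k V f g = -(sgn k (i * j) • superComm k V g f) := by
  ext x
  simp only [LinearMap.neg_apply, LinearMap.smul_apply, superComm_apply hf hg,
    superComm_apply hg hf]
  rcases parity_cases i with rfl | rfl <;> rcases parity_cases j with rfl | rfl <;> simp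

lemma isLieSuperalgebra_derBracket (p : V →ₗ[k] V →ₗ[k] V) :
    IsLieSuperalgebra (derBracket p) := by
  have hd : ∀ {i} {x : Der p}, x ∈ gr k (Der p) i →
      (x : Module.End k V) ∈ gr k (Module.End k V) i := fun {i x} hx => hx.1
  have hm : ∀ i j, ∀ x ∈ gr k (Der p) i, ∀ y ∈ gr k (Der p) j,
      derBracket p x y ∈ gr k (Der p) (i + j) := by
    intro i j x hx y hy
    change x.1 ∈ derPart p i at hx
    change y.1 ∈ derPart p j at hy
    change superComm k V x.1 y.1 ∈ derPart p (i + j)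
    refine ⟨superComm_mem hx.1 hy.1, fun l v hv w => ?_⟩
    simp only [superComm_apply hx.1 hy.1]
    rw [hy.2 l v hv, hx.2 l v hv, map_add, map_add, map_smul, map_smul,
      hx.2 _ _ (hy.1 _ _ hv), hx.2 l v hv, hy.2 _ _ (hx.1 _ _ hv), hy.2 l v hv]
    rcases parity_cases i with rfl | rfl <;> rcases parity_cases j with rfl | rfl <;>
      rcases parity_cases l with rfl | rfl <;> simp <;> abel
  refine ⟨hm, ?_, ?_, ?_, ?_⟩
  · exact fun i j x hx y hy => Subtype.ext (superComm_skew (hd hx) (hd hy))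
  · intro i j l x hx y hy z hz
    refine Subtype.ext (LinearMap.ext fun v => ?_)
    simp only [Submodule.coe_add, Submodule.coe_smul, derBracket_coe, LinearMap.add_apply,
      LinearMap.smul_apply, superComm_apply (hd hx) (superComm_mem (hd hy) (hd hz)),
      superComm_apply (superComm_mem (hd hx) (hd hy)) (hd hz), superComm_apply (hd hy) (hd hz),
      superComm_apply (hd hy) (superComm_mem (hd hx) (hd hz)), superComm_apply (hd hx) (hd hy),
      superComm_apply (hd hx) (hd hz), map_sub, map_smul]
    rcases parity_cases i with rfl | rfl <;> rcases parity_cases j with rfl | rfl <;>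
      rcases parity_cases l with rfl | rfl <;> simp <;> abel
  · intro x hx
    refine Subtype.ext (LinearMap.ext fun v => ?_)
    simp [derBracket_coe, superComm_apply (hd hx) (hd hx)]
  -- For odd x the square bracket [x, x] is 2x², which is even and commutes with x. The condition
  -- thus holds in characteristic 3 as well.
  · intro x hx
    refine Subtype.ext (LinearMap.ext fun v => ?_)
    simp [derBracket_coe, superComm_apply (hd hx) (superComm_mem (hd hx) (hd hx)),
      superComm_apply (hd hx) (hd hx)]

/-- A superalgebra isomorphic to a Lie superalgebra is a Lie superalgebra. -/
lemma IsSuperIso.isLieSuperalgebra {W : Type*} [AddCommGroup W] [Module k W] [Superspace k W]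
    {br : V →ₗ[k] V →ₗ[k] V} {br' : W →ₗ[k] W →ₗ[k] W} {f : V →ₗ[k] W}
    (hf : IsSuperIso br br' f) (h : IsLieSuperalgebra br') : IsLieSuperalgebra br where
  even i j x hx y hy := by
    have h1 := h.even i j _ (hf.even i x hx) _ (hf.even j y hy)
    rw [← hf.map_br] at h1
    -- The map f is only known to preserve parity, so parity is reflected as follows: f commutes
    -- with the projections, the wrong component of `f (br x y)` is zero, and f is injective.
    have h2 : ∀ l, l ≠ i + j → proj k l (br x y) = 0 := by
      intro l hl
      refine hf.bijective.1 ?_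
      have e := congrArg f (proj_add_proj (k := k) (br x y))
      have h3 : proj k l (f (br x y)) = f (proj k l (br x y)) := by
        have m0 := hf.even 0 _ (proj_mem (k := k) 0 (br x y))
        have m1 := hf.even 1 _ (proj_mem (k := k) 1 (br x y))
        rw [← e, map_add, map_add]
        rcases parity_cases l with rfl | rfl
        · rw [proj_of_mem m0, proj_of_mem_ne m1 (by simp), add_zero]
        · rw [proj_of_mem m1, proj_of_mem_ne m0 (by simp), zero_add]
      rw [← h3, proj_of_mem_ne h1 hl, map_zero]
    rw [← proj_add_proj (k := k) (br x y)]
    rcases parity_cases (i + j) with e | e <;> rw [e] at h2 ⊢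
    · rw [h2 1 (by simp), add_zero]
      exact proj_mem _ _
    · rw [h2 0 (by simp), zero_add]
      exact proj_mem _ _
  skew i j x hx y hy := hf.bijective.1 <| by
    rw [map_neg, map_smul, hf.map_br, hf.map_br]
    exact h.skew i j _ (hf.even i x hx) _ (hf.even j y hy)
  jacobi i j l x hx y hy z hz := hf.bijective.1 <| by
    simp only [map_add, map_smul, hf.map_br]
    exact h.jacobi i j l _ (hf.even i x hx) _ (hf.even j y hy) _ (hf.even l z hz)
  self_even x hx := hf.bijective.1 <| by
    rw [map_zero, hf.map_br]
    exact h.self_even _ (hf.even 0 x hx)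
  self_odd x hx := hf.bijective.1 <| by
    rw [map_zero, hf.map_br, hf.map_br]
    exact h.self_odd _ (hf.even 1 x hx)

end General

namespace HurwitzSuperalgebra

variable {k : Type*} [Field k] {V : Type*} [AddCommGroup V] [Module k V] [Superspace k V]
  (C : HurwitzSuperalgebra k V) [NeZero (2 : k)]

/-! ### Brackets of the derivations `D_d` and `D_i(a)` -/

lemma superComm_DTri_DTri {p r : ZMod 2} {d f : Fin 3 → Module.End k V}
    (hd : ∀ m, d m ∈ gr k (Module.End k V) p) (hf : ∀ m, f m ∈ gr k (Module.End k V) r) :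
    superComm k C.J (C.DTri d) (C.DTri f) = C.DTri fun m => superComm k V (d m) (f m) := by
  refine C.J_ext (fun i => ?_) fun i j a _ => ?_
  · simp [superComm_apply (C.DTri_mem_end hd) (C.DTri_mem_end hf)]
  · simp [superComm_apply (C.DTri_mem_end hd) (C.DTri_mem_end hf), superComm_apply (hd _) (hf _)]

/-- The relations that make D_d a derivation reappear: skewness of d_i on ι_i(C), and a rotated
triality relation on each of the other two pieces. -/
lemma superComm_DTri_DL {p r : ZMod 2} {d : Fin 3 → Module.End k V} (hd : d ∈ C.para.triPart p)
    (i : Fin 3) {a : V} (ha : a ∈ gr k V r) :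
    superComm k C.J (C.DTri d) (C.DL i a) = C.DL i (d i a) := by
  have hc := superComm_apply (C.DTri_mem hd).1 (C.DL_mem i ha).1
  refine C.J_ext (fun m => ?_) fun m j b hb => ?_
  · rw [hc]
    rcases fin_three_cases i m with rfl | rfl | rfl <;> simp
  · have ha' := (hd.1 i).1 _ a ha
    rw [hc]
    rcases fin_three_cases i m with rfl | rfl | rfl
    · have h := (hd.1 i).2 _ a ha b
      change C.b _ _ + _ * C.b _ _ = 0 at h
      simp only [DL_iota_self, DTri_iota, map_smul, map_sub, DTri_e]
      linear_combination (norm := module) (-2 * h) • (C.e (i + 2) - C.e (i + 1))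
    · have h := congrArg (C.iotaL (i + 2)) (triPart_rot C.para hd i ha b)
      simp only [map_add, map_smul, map_neg, DL_iota_add_one, DTri_iota] at h ⊢
      linear_combination (norm := module) -h
    · have h := congrArg (C.iotaL (i + 1)) (triPart_rot C.para hd (i + 2) hb a)
      rw [fin_three_add_two_one, fin_three_add_two_two] at h
      simp only [map_add, map_smul, C.DL_iota_add_two i ha hb, C.DL_iota_add_two i ha' hb,
        C.DL_iota_add_two i ha ((hd.1 (i + 2)).1 _ b hb), DTri_iota] at h ⊢
      rw [h]
      rcases parity_cases p with rfl | rfl <;> rcases parity_cases r with rfl | rfl <;>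
        rcases parity_cases j with rfl | rfl <;> simp

/-- This is the origin of t_{a,b}. On ι_i(C) the composites pass through the idempotents and give
σ_{a,b}. On the other two pieces they give two iterated products; a composition identity trades one
of them for b(a,b) minus the other, up to signs, so that the other is doubled. The shift `m - i` is
θ^i. -/
lemma superComm_DL_DL_self {p r : ZMod 2} (i : Fin 3) {a b : V} (ha : a ∈ gr k V p)
    (hb : b ∈ gr k V r) : superComm k C.J (C.DL i a) (C.DL i b) =
      (2 : k) • C.DTri fun m => C.para.t a b (m - i) := by
  have hc := superComm_apply (C.DL_mem i ha).1 (C.DL_mem i hb).1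
  have ht := inv_two_mul (k := k)
  refine C.J_ext (fun m => ?_) fun m l c hcl => ?_
  · rw [hc]
    have h2 := C.b_symm _ _ b hb a ha
    rcases fin_three_cases i m with rfl | rfl | rfl
    · simp
    · simp only [DL_e_add_one, map_smul, DL_iota_self, LinearMap.smul_apply, DTri_e, h2]
      rw [mul_comm r p]
      have hs := sgn_mul_self (k := k) (p * r)
      match_scalars <;> grind
    · simp only [DL_e_add_two, map_neg, map_smul, DL_iota_self, LinearMap.smul_apply, DTri_e, h2]
      rw [mul_comm r p]
      have hs := sgn_mul_self (k := k) (p * r)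
      match_scalars <;> grind
  · rw [hc, LinearMap.smul_apply, DTri_iota]
    rcases fin_three_cases i m with rfl | rfl | rfl
    · have h := C.para.sigma_apply ha hb hcl
      have h1 := C.b_even _ _ a ha c hcl
      have h2 := C.b_even _ _ b hb c hcl
      change _ = (_ * C.b a c) • b - (_ * C.b b c) • a at h
      rw [sub_self, show C.para.t a b 0 = C.para.sigma a b from rfl, h]
      simp only [DL_iota_self, map_smul, map_sub, DL_e_add_one, DL_e_add_two]
      rcases parity_cases p with rfl | rfl <;> rcases parity_cases r with rfl | rfl <;>
        rcases parity_cases l with rfl | rfl <;> simp at h1 h2 ⊢ <;> match_scalars <;> grind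
    · have h := C.para.t_one_apply ha hb hcl
      have h3 := congrArg (C.iotaL (i + 1)) (C.para.mul_mul_left ha hcl hb)
      change _ = (_ * C.b a b) • _ - _ at h
      rw [add_sub_cancel_left, h]
      simp only [map_add, map_sub, map_smul, map_neg, DL_iota_add_one,
        C.DL_iota_add_two i ha (C.para.mul_mem _ _ _ hb _ hcl),
        C.DL_iota_add_two i hb (C.para.mul_mem _ _ _ ha _ hcl)] at h3 ⊢
      change _ = (_ * C.b a b) • _ at h3
      linear_combination (norm := skip) sgn k (l * r) • h3
      rcases parity_cases p with rfl | rfl <;> rcases parity_cases r with rfl | rfl <;>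
        rcases parity_cases l with rfl | rfl <;> simp <;> match_scalars <;> grind
    · have h := C.para.t_two_apply (x := a) hb hcl
      have h3 := congrArg (C.iotaL (i + 2)) (C.para.mul_mul_right ha hcl hb)
      change _ = (_ * C.b a b) • _ - _ at h
      rw [add_sub_cancel_left, h]
      simp only [map_add, map_sub, map_smul, DL_iota_add_one, C.DL_iota_add_two i ha hcl,
        C.DL_iota_add_two i hb hcl] at h3 ⊢
      change _ = (_ * C.b a b) • _ at h3
      have h4 := C.b_even _ _ a ha b hb
      linear_combination (norm := skip) sgn k (l * r) • h3
      rcases parity_cases p with rfl | rfl <;> rcases parity_cases r with rfl | rfl <;>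
        rcases parity_cases l with rfl | rfl <;> simp at h4 ⊢ <;> match_scalars <;> grind

/-- On ι_i(C), ι_{i+1}(C) and ι_{i+2}(C) the formula reduces respectively to `mul_mul_left`,
`mul_mul_right` and the associativity of b. -/
lemma superComm_DL_DL_succ {p r : ZMod 2} (i : Fin 3) {a b : V} (ha : a ∈ gr k V p)
    (hb : b ∈ gr k V r) : superComm k C.J (C.DL i a) (C.DL (i + 1) b) =
      C.DL (i + 2) (C.para.mul a b) := by
  have hc := superComm_apply (C.DL_mem i ha).1 (C.DL_mem (i + 1) hb).1
  have ht := inv_two_mul (k := k)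
  have hab := C.para.mul_mem _ _ _ ha _ hb
  refine C.J_ext (fun m => ?_) fun m l c hcl => ?_
  · have h1 := C.DL_e_add_one (i + 1) b
    have h2 := C.DL_e_add_two (i + 1) b
    have h3 := C.DL_e_add_one (i + 2) (C.para.mul a b)
    have h4 := C.DL_e_add_two (i + 2) (C.para.mul a b)
    have h5 := C.DL_iota_add_two (i + 1) hb ha
    rw [fin_three_add_one_one] at h1
    rw [fin_three_add_one_two] at h2 h5
    rw [fin_three_add_two_one] at h3
    rw [fin_three_add_two_two] at h4
    rw [fin_three_add_one_one] at h5
    have hs : ∀ A : C.J, sgn k (p * r) • sgn k (r * p) • A = A := fun A => by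
      rw [mul_comm r p, smul_smul, sgn_mul_self, one_smul]
    rw [hc]
    rcases fin_three_cases i m with rfl | rfl | rfl
    · simp [h2, h3]
    · simp only [h4, h5, hs, DL_e_self, DL_e_add_one, map_smul, map_zero, zero_sub,
        smul_comm (sgn k (p * r)) (2⁻¹ : k)]
    · simp only [h1, h5, hs, DL_e_self, DL_e_add_two, DL_iota_add_one, map_smul, map_neg,
        smul_neg, sub_neg_eq_add, smul_comm (sgn k (p * r)) (2⁻¹ : k), neg_add_cancel]
  · rw [hc]
    rcases fin_three_cases i m with rfl | rfl | rfl
    · have h1 := C.DL_iota_add_two (i + 1) hb hcl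
      have h2 := C.DL_iota_add_one (i + 2) (C.para.mul a b) c
      have h3 := congrArg (C.iotaL (i + 1)) (C.para.mul_mul_left ha hb hcl)
      have h4 := C.DL_e_add_one (i + 1) b
      have h5 := C.b_even _ _ a ha c hcl
      rw [fin_three_add_one_two, fin_three_add_one_one] at h1
      rw [fin_three_add_two_one, fin_three_add_two_two] at h2
      rw [fin_three_add_one_one] at h4
      simp only [h1, h2, h4, map_add, map_smul, DL_iota_self, map_sub, DL_e_self,
        C.DL_iota_add_two i ha (C.para.mul_mem _ _ _ hcl _ hb)] at h3 ⊢
      change _ = (_ * C.b a c) • _ at h3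
      linear_combination (norm := skip) h3
      rcases parity_cases p with rfl | rfl <;> rcases parity_cases r with rfl | rfl <;>
        rcases parity_cases l with rfl | rfl <;> simp at h5 ⊢ <;> match_scalars <;> grind
    · have h1 := C.DL_iota_add_one (i + 1) b (C.para.mul a c)
      have h2 := C.DL_iota_add_two (i + 2) hab hcl
      have h3 := congrArg (C.iotaL i) (C.para.mul_mul_right hb ha hcl)
      rw [fin_three_add_one_two, fin_three_add_one_one] at h1
      have h4 := C.DL_iota_self (i + 1) b c
      rw [fin_three_add_two_one, fin_three_add_two_two] at h2
      rw [fin_three_add_one_two, fin_three_add_one_one] at h4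
      simp only [h1, h2, h4, map_add, map_smul, map_sub, map_neg, DL_e_self, DL_e_add_two,
        DL_iota_add_one] at h3 ⊢
      change _ = (_ * C.b b c) • _ at h3
      linear_combination (norm := skip) (-sgn k (p * r)) • h3
      rcases parity_cases p with rfl | rfl <;> rcases parity_cases r with rfl | rfl <;>
        rcases parity_cases l with rfl | rfl <;> simp <;> match_scalars <;> grind
    · have h1 := C.DL_iota_add_one (i + 1) b c
      have h2 := C.DL_iota_self (i + 1) b (C.para.mul c a)
      have h3 := C.DL_iota_self (i + 2) (C.para.mul a b) c
      have h4 := C.para.assoc a b c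
      have h5 := C.para.assoc b c a
      have h6 := C.para.b_symm _ _ _ (C.para.mul_mem _ _ _ hb _ hcl) _ ha
      change C.b _ _ = C.b _ _ at h4 h5
      change C.b _ _ = _ * C.b _ _ at h6
      rw [fin_three_add_one_two, fin_three_add_one_one] at h1 h2
      rw [fin_three_add_two_one, fin_three_add_two_two] at h3
      simp only [h1, h2, h3, map_smul, map_neg, DL_iota_self, C.DL_iota_add_two i ha hcl, h4,
        ← h5, h6]
      rcases parity_cases p with rfl | rfl <;> rcases parity_cases r with rfl | rfl <;>
        rcases parity_cases l with rfl | rfl <;> simp <;> module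

/-! ### The form of a derivation of `J` -/

lemma coord_e_mul (m n : Fin 3) (A : C.J) :
    C.coord n (C.jordanMul (C.e m) A) = if m = n then 0 else (2⁻¹ : k) • C.coord n A := by
  have h : C.coord n ∘ₗ C.jordanMul (C.e m) =
      (if m = n then (0 : k) else 2⁻¹) • C.coord n := by
    refine C.J_ext (fun i => ?_) fun i j a _ => ?_
    · simp only [LinearMap.comp_apply, LinearMap.smul_apply, e_mul_e, coord_e, smul_zero]
      split_ifs <;> simp [coord_e]
    · simp only [LinearMap.comp_apply, LinearMap.smul_apply, e_mul_iota, coord_iota]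
      by_cases h1 : n = i
      · subst h1
        by_cases h2 : m = n <;> simp [h2, coord_iota]
      · by_cases h2 : m = i <;> simp [h1, h2, coord_iota]
  have := LinearMap.congr_fun h A
  rw [LinearMap.comp_apply] at this
  rw [this]
  split_ifs <;> simp

lemma e_mul (m : Fin 3) (A : C.J) : C.jordanMul (C.e m) A = C.diagCoord m A • C.e m +
    (2⁻¹ : k) • (C.iotaL (m + 1) (C.coord (m + 1) A) + C.iotaL (m + 2) (C.coord (m + 2) A)) := by
  conv_lhs => rw [C.decomposition A]
  simp only [map_add, map_sum, map_smul, e_mul_e, e_mul_iota, smul_ite, smul_zero,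
    Finset.sum_ite_eq, Finset.mem_univ, if_true]
  congr 1
  fin_cases m <;> simp [Fin.sum_univ_three, add_comm]

/-- The Peirce 1/2-space of e_m contains no diagonal part. -/
lemma e_mul_of_half {m : Fin 3} {A : C.J} (h : C.jordanMul (C.e m) A = (2⁻¹ : k) • A) :
    A = C.iotaL (m + 1) (C.coord (m + 1) A) + C.iotaL (m + 2) (C.coord (m + 2) A) := by
  have ht := inv_two_mul (k := k)
  have h1 := C.e_mul m A
  have h2 := congrArg (C.jordanMul (C.e m)) h1
  have n1 : m ≠ m + 1 := by simp
  have n2 : m ≠ m + 2 := by simp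
  rw [h] at h1 h2
  simp only [map_add, map_smul, h, e_mul_e, e_mul_iota, if_true, n1, n2, if_false] at h2
  -- With δ the coefficient of e_m and B the asserted value, h1 reads A/2 = δ e_m + B/2, and a
  -- second multiplication by e_m gives A/4 = δ e_m + B/4 in h2. The combination eliminates δ.
  linear_combination (norm := skip) (4 : k) • h1 - (4 : k) • h2
  match_scalars <;> grind

/-- Differentiating e_i ∘ e_i = e_i gives 2 e_i ∘ X(e_i) = X(e_i), so X(e_i) lies in the Peirce
1/2-space of e_i. -/
lemma derPart_e {p : ZMod 2} {X : Module.End k C.J} (hX : X ∈ derPart C.jordanMul p)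
    (i : Fin 3) : X (C.e i) = C.iotaL (i + 1) (C.coord (i + 1) (X (C.e i))) +
      C.iotaL (i + 2) (C.coord (i + 2) (X (C.e i))) := by
  have ht := inv_two_mul (k := k)
  refine C.e_mul_of_half ?_
  have h := hX.2 0 (C.e i) (C.e_mem i) (C.e i)
  rw [C.jordanMul_comm (hX.1 _ _ (C.e_mem i)) (C.e_mem i), e_mul_e, if_pos rfl] at h
  simp only [mul_zero, sgn_zero, one_smul] at h
  linear_combination (norm := skip) (-(2⁻¹ : k)) • h
  match_scalars <;> grind

/-- This is the ι_{i+2}-coordinate of the derivative of e_i ∘ e_{i+1} = 0. -/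
lemma coord_derPart_e {p : ZMod 2} {X : Module.End k C.J} (hX : X ∈ derPart C.jordanMul p)
    (i : Fin 3) : C.coord (i + 2) (X (C.e i)) = -C.coord (i + 2) (X (C.e (i + 1))) := by
  have n1 : i ≠ i + 1 := by simp
  have n2 : i ≠ i + 2 := by simp
  have n3 : i + 1 ≠ i + 2 := by simp
  have h := congrArg (C.coord (i + 2)) (hX.2 0 (C.e i) (C.e_mem i) (C.e (i + 1)))
  rw [C.jordanMul_comm (hX.1 _ _ (C.e_mem i)) (C.e_mem (i + 1)), e_mul_e, if_neg n1] at h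
  simp only [mul_zero, sgn_zero, one_smul, map_add, map_zero, coord_e_mul, n2, n3,
    if_false] at h
  rw [← smul_add, eq_comm, smul_eq_zero] at h
  exact eq_neg_of_add_eq_zero_left (h.resolve_left (inv_ne_zero (NeZero.ne _)))

/-- Such an X commutes with every L_{e_m}, so it preserves their joint eigenspaces. Eigenvalue 1/2
for e_{i+1} leaves only the coordinates i and i+2, and eigenvalue 0 for e_i excludes i+2. -/
lemma derPart_iota {p : ZMod 2} {X : Module.End k C.J} (hX : X ∈ derPart C.jordanMul p)
    (he : ∀ i, X (C.e i) = 0) (i : Fin 3) (a : V) :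
    X (C.iotaL i a) = C.iotaL i (C.coord i (X (C.iotaL i a))) := by
  have hm : ∀ m, C.jordanMul (C.e m) (X (C.iotaL i a)) =
      if m = i then 0 else (2⁻¹ : k) • X (C.iotaL i a) := by
    intro m
    have h := hX.2 0 (C.e m) (C.e_mem m) (C.iotaL i a)
    simp only [he, mul_zero, sgn_zero, one_smul, map_zero, LinearMap.zero_apply, zero_add,
      e_mul_iota] at h
    rw [← h]
    split_ifs <;> simp
  have h1 := C.e_mul_of_half ((hm (i + 1)).trans (if_neg (by simp)))
  have h2 := congrArg (C.coord (i + 2)) (hm i)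
  have n2 : i ≠ i + 2 := by simp
  rw [coord_e_mul, if_pos rfl, if_neg n2, map_zero, smul_eq_zero] at h2
  rw [fin_three_add_one_one, fin_three_add_one_two,
    h2.resolve_left (inv_ne_zero (NeZero.ne _)), map_zero, zero_add] at h1
  exact h1

/-- A derivation of `J` that kills the idempotents `e_i` has the form `D_d`. -/
lemma exists_eq_DTri {p : ZMod 2} {X : Module.End k C.J} (hX : X ∈ derPart C.jordanMul p)
    (he : ∀ i, X (C.e i) = 0) : ∃ d ∈ C.para.triPart p, X = C.DTri d := by
  have hi := C.derPart_iota hX he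
  set d : Fin 3 → Module.End k V := fun i => C.coord i ∘ₗ X ∘ₗ C.iotaL i with hd
  have hdX : ∀ i a, X (C.iotaL i a) = C.iotaL i (d i a) := hi
  refine ⟨d, ⟨fun m => ⟨fun j a ha => ?_, fun j a ha b => ?_⟩, fun j a ha b => ?_⟩, ?_⟩
  · exact C.coord_mem m (hX.1 _ _ (C.iotaL_mem m ha))
  · change C.b _ _ + _ * C.b _ _ = 0
    have h := hX.2 j (C.iotaL m a) (C.iotaL_mem m ha) (C.iotaL m b)
    simp only [iota_mul_iota_self, map_smul, map_add, he, hdX, add_zero, smul_zero] at h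
    -- The diagonal entry at m+1 isolates the coefficient of e_{m+1}, a multiple of the unit of C.
    have h1 := congrFun (congrFun (congrArg C.toMatrix h) (m + 1)) (m + 1)
    simp only [map_add, map_smul, map_zero, toMatrix_e, Matrix.add_apply, Matrix.smul_apply,
      Matrix.zero_apply, Matrix.single_apply] at h1
    have n3 : m + 2 ≠ m + 1 := by simp
    simp only [n3, and_self, if_true, if_false, add_zero, smul_smul, ← add_smul] at h1
    rcases smul_eq_zero.1 h1.symm with h2 | h2
    · refine (mul_eq_zero.1 ?_).resolve_left (NeZero.ne (2 : k))
      linear_combination h2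
    -- The zero superalgebra is not excluded: if 1 = 0 in C, then C = 0 and there is nothing to
    -- prove.
    · have hV : ∀ x : V, x = 0 := fun x => by rw [← C.one_mul x, h2, map_zero, LinearMap.zero_apply]
      simp [hV b]
  · have h := hX.2 j (C.iotaL 1 a) (C.iotaL_mem 1 ha) (C.iotaL 2 b)
    have h1 : ∀ a b : V, C.jordanMul (C.iotaL 1 a) (C.iotaL 2 b) = C.iotaL 0 (C.para.mul a b) :=
      fun a b => C.iota_mul_iota_succ 1 a b
    simp only [hdX, h1] at h
    refine C.iotaL_injective 0 ?_
    rw [h, map_add, map_smul]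
  · refine C.J_ext (fun i => ?_) fun i j a _ => ?_
    · simp [he]
    · rw [hdX, DTri_iota]

/-- In a sum of derivations D_j(a_j), the ι_i-coordinate of the image of an idempotent sees only
a_i. This is what allows the three a_i to be determined independently. -/
lemma coord_DL_e (i j m : Fin 3) (a : V) : C.coord i (C.DL j a (C.e m)) =
    if i = j then C.coord i (C.DL i a (C.e m)) else 0 := by
  split_ifs with h
  · rw [h]
  · rcases fin_three_cases j m with rfl | rfl | rfl <;> simp [coord_iota, h]

/-- Every derivation of `J` is the sum of a derivation `D_d` and of derivations `D_i(a)`. -/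
lemma exists_eq_DTri_add_DL {p : ZMod 2} {X : Module.End k C.J}
    (hX : X ∈ derPart C.jordanMul p) : ∃ d ∈ C.para.triPart p, ∃ a : Fin 3 → V,
      X = C.DTri d + ∑ i, C.DL i (a i) := by
  -- The factor 2 compensates D_i(a)(e_{i+1}) = ι_i(a)/2.
  set a : Fin 3 → V := fun i => (2 : k) • C.coord i (X (C.e (i + 1))) with ha
  have hY : X - ∑ i, C.DL i (a i) ∈ derPart C.jordanMul p := by
    refine sub_mem hX (Submodule.sum_mem _ fun i _ => C.DL_mem i ?_)
    have := C.coord_mem i (hX.1 _ _ (C.e_mem (i + 1)))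
    rw [add_zero] at this
    exact Submodule.smul_mem _ _ this
  have h1 : ∀ i, C.coord i ((X - ∑ i, C.DL i (a i)) (C.e (i + 1))) = 0 := by
    intro i
    rw [LinearMap.sub_apply, LinearMap.sum_apply, map_sub, map_sum, Finset.sum_eq_single i]
    · simp [ha, coord_iota, smul_smul, mul_inv_cancel₀ (NeZero.ne (2 : k))]
    · intro j _ hj
      rw [coord_DL_e, if_neg hj.symm]
    · simp
  -- The choice of a cancels one of the two coordinates of the image of each idempotent; the other
  -- is tied to it by `coord_derPart_e`.
  have h2 : ∀ i, C.coord (i + 1) ((X - ∑ i, C.DL i (a i)) (C.e i)) = 0 := by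
    intro i
    have h3 := C.coord_derPart_e hY (i + 2)
    have h4 := h1 (i + 1)
    rw [fin_three_add_one_one] at h4
    rw [fin_three_add_two_one, fin_three_add_two_two, h4] at h3
    exact neg_eq_zero.1 h3.symm
  obtain ⟨d, hd, h⟩ := C.exists_eq_DTri hY fun i => by
    have h3 := h1 (i + 2)
    rw [fin_three_add_two_one] at h3
    rw [C.derPart_e hY, h2, h3, map_zero, map_zero, add_zero]
  exact ⟨d, hd, a, by rw [← h, sub_add_cancel]⟩

lemma DTri_injective : Function.Injective C.DTri := fun d f h => by
  funext i
  ext1 a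
  refine C.iotaL_injective i ?_
  rw [← DTri_iota, ← DTri_iota, h]

/-- D_d kills e_{i+1}, so evaluation there recovers a_i. What remains is the injectivity of d ↦ D_d.
-/
lemma DTri_add_DL_eq_zero {d : Fin 3 → Module.End k V} {a : Fin 3 → V}
    (h : C.DTri d + ∑ i, C.DL i (a i) = 0) : d = 0 ∧ a = 0 := by
  have ha : a = 0 := by
    funext i
    have h1 := congrArg (C.coord i) (LinearMap.congr_fun h (C.e (i + 1)))
    rw [LinearMap.add_apply, LinearMap.sum_apply, map_add, map_sum, Finset.sum_eq_single i] at h1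
    · simpa [coord_iota, NeZero.ne (2 : k)] using h1
    · intro j _ hj
      rw [coord_DL_e, if_neg hj.symm]
    · simp
  refine ⟨C.DTri_injective ?_, ha⟩
  simpa [ha] using h

end HurwitzSuperalgebra

/-! ### The ingredients of the bracket of 𝔤(S', S) -/

section Magic

variable {k : Type*} [Field k] {V : Type*} [AddCommGroup V] [Module k V] [Superspace k V]

lemma signedTensor_apply {V' X X' : Type*} [AddCommGroup V'] [Module k V'] [Superspace k V']
    [AddCommGroup X] [Module k X] [AddCommGroup X'] [Module k X']
    (s : ZMod 2 → ZMod 2 → ZMod 2 → ZMod 2 → ZMod 2)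
    (f : V →ₗ[k] V →ₗ[k] X) (g : V' →ₗ[k] V' →ₗ[k] X') {i i' j j' : ZMod 2} {x y : V} {x' y' : V'}
    (hx : x ∈ gr k V i) (hx' : x' ∈ gr k V' i') (hy : y ∈ gr k V j) (hy' : y' ∈ gr k V' j') :
    signedTensor s f g (x ⊗ₜ x') (y ⊗ₜ y') = sgn k (s i i' j j') • (f x y ⊗ₜ[k] g x' y') := by
  simp only [signedTensor, LinearMap.sum_apply, LinearMap.smul_apply, LinearMap.compl₁₂_apply,
    TensorProduct.map_tmul, TensorProduct.map₂_apply_tmul]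
  rw [Finset.sum_eq_single i, Finset.sum_eq_single i', Finset.sum_eq_single j,
    Finset.sum_eq_single j', proj_of_mem hx, proj_of_mem hx', proj_of_mem hy, proj_of_mem hy']
  · intro m _ h
    simp [proj_of_mem_ne hy' h]
  · simp
  · intro m _ h
    simp [proj_of_mem_ne hy h]
  · simp
  · intro m _ h
    simp [proj_of_mem_ne hx' h]
  · simp
  · intro m _ h
    simp [proj_of_mem_ne hx h]
  · simp

lemma SymmetricCompositionSuperalgebra.theta_pow_apply (S : SymmetricCompositionSuperalgebra k V)
    (i : Fin 3) (d : S.tri) (m : Fin 3) :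
    ((S.theta ^ (i : ℕ)) d : Fin 3 → Module.End k V) m = (d : Fin 3 → Module.End k V) (m - i) := by
  have h : ∀ d : S.tri, ∀ m : Fin 3,
    (S.theta d : Fin 3 → Module.End k V) m = (d : Fin 3 → Module.End k V) (m - 1) :=
    fun _ _ => rfl
  fin_cases i
  · simp
  · simp [h]
  · simp only [Fin.reduceFinMk, pow_two, Fin.isValue, Module.End.mul_apply, h]
    exact congrArg _ ((by decide : ∀ m : Fin 3, m - 1 - 1 = m - 2) m)

namespace MagicAlgebra

variable {V' : Type*} [AddCommGroup V'] [Module k V'] [Superspace k V']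
  (S : SymmetricCompositionSuperalgebra k V) (S' : SymmetricCompositionSuperalgebra k V')

lemma upperPart_apply (x y : MagicAlgebra S S') : upperPart S S' x y =
    ∑ i : Fin 3, (iota S S' i (((triComp S S' x : Fin 3 → Module.End k V) i).rTensor V'
        (comp S S' i y)) +
      iota S S' i (signedLTensor k V V' ((triComp' S S' x : Fin 3 → Module.End k V') i)
        (comp S S' i y)) +
      iota S S' (i + 2) (tensorMul S S' (comp S S' i x) (comp S S' (i + 1) y))) := by
  simp only [upperPart, LinearMap.add_apply, LinearMap.sum_apply]
  rfl

lemma signedLTensor_one (d : Module.End k V) (a : V) :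
    signedLTensor k k V d (1 ⊗ₜ[k] a) = 1 ⊗ₜ[k] d a := by
  have h0 : proj k 0 (1 : k) = 1 := proj_of_mem (mem_gr_self_zero _)
  have h1 : proj k 1 (1 : k) = 0 := proj_of_mem_ne (mem_gr_self_zero (1 : k)) (by simp)
  simp only [signedLTensor, LinearMap.sum_apply, LinearMap.smul_apply, LinearMap.compl₁₂_apply,
    LinearMap.rTensor_tmul, LinearMap.coe_lTensorHom]
  simp only [sum_parity, h0, h1, LinearMap.lTensor_tmul, TensorProduct.zero_tmul,
    smul_zero, add_zero, mul_zero, sgn_zero, one_smul]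
  rw [← TensorProduct.tmul_add, ← LinearMap.add_apply, proj_add_proj]

lemma comp_iota (i j : Fin 3) (u : V ⊗[k] V') :
    comp S S' i (iota S S' j u) = if i = j then u else 0 := by
  change (Pi.single j u : Fin 3 → V ⊗[k] V') i = _
  by_cases h : i = j
  · subst h; simp
  · simp [h]

@[simp] lemma comp_ofTri' (i : Fin 3) (d : S'.tri) : comp S S' i (ofTri' S S' d) = 0 := rfl

@[simp] lemma triComp'_ofTri' (d : S'.tri) : triComp' S S' (ofTri' S S' d) = d := rfl

@[simp] lemma triComp'_iota (i : Fin 3) (u : V ⊗[k] V') :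
    triComp' S S' (iota S S' i u) = 0 := rfl

@[simp] lemma triComp_iota (i : Fin 3) (u : V ⊗[k] V') :
    triComp S S' (iota S S' i u) = 0 := rfl

@[simp] lemma triComp_ofTri' (d : S'.tri) : triComp S S' (ofTri' S S' d) = 0 := rfl

lemma ofTri'_mem {i : ZMod 2} {d : S'.tri} (hd : d ∈ gr k S'.tri i) :
    ofTri' S S' d ∈ gr k (MagicAlgebra S S') i :=
  ⟨⟨zero_mem _, hd⟩, fun _ _ => zero_mem _⟩

lemma tmul_mem {i j : ZMod 2} {x : V} {y : V'} (hx : x ∈ gr k V i) (hy : y ∈ gr k V' j) :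
    x ⊗ₜ[k] y ∈ gr k (V ⊗[k] V') (i + j) := by
  change _ ∈ ⨆ l : ZMod 2, Submodule.map₂ (TensorProduct.mk k V V') (gr k V l)
    (gr k V' (i + j + l))
  refine Submodule.mem_iSup_of_mem i (Submodule.apply_mem_map₂ _ hx ?_)
  rw [add_right_comm]
  rcases parity_cases i with rfl | rfl <;> simpa using hy

lemma iota_mem (i : Fin 3) {j : ZMod 2} {u : V ⊗[k] V'} (hu : u ∈ gr k (V ⊗[k] V') j) :
    iota S S' i u ∈ gr k (MagicAlgebra S S') j := by
  refine ⟨zero_mem _, fun m _ => ?_⟩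
  change (Pi.single i u : Fin 3 → V ⊗[k] V') m ∈ _
  by_cases h : m = i
  · subst h; simpa using hu
  · simp [h]

/-! ### The superalgebra `𝔤(S₁, S)` -/

variable [NeZero (2 : k)]

lemma bracket_apply {i j : ZMod 2} {x y : MagicAlgebra S S'}
    (hx : x ∈ gr k (MagicAlgebra S S') i) (hy : y ∈ gr k (MagicAlgebra S S') j) :
    bracket S S' x y = diagPart S S' x y + (upperPart S S' x y -
      sgn k (i * j) • upperPart S S' y x) := by
  rw [bracket, LinearMap.add_apply, LinearMap.add_apply, superSkew, LinearMap.sub_apply,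
    LinearMap.sub_apply, superFlip_apply _ hx hy]

lemma diagPart_apply (x y : MagicAlgebra S S') : diagPart S S' x y =
    ofTri S S' (S.triBracket (triComp S S' x) (triComp S S' y)) +
    ofTri' S S' (S'.triBracket (triComp' S S' x) (triComp' S S' y)) +
    ∑ i : Fin 3, (ofTri S S' ((S.theta ^ (i : ℕ)) (toTri S S' (comp S S' i x) (comp S S' i y))) +
      ofTri' S S' ((S'.theta ^ (i : ℕ)) (toTri' S S' (comp S S' i x) (comp S S' i y)))) := by
  simp only [diagPart, LinearMap.add_apply, LinearMap.sum_apply]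
  rfl

/-- Already osp(S_1, q) is zero: for even d, skewness at (1, 1) reads 4 d(1) = 0, and an odd d sends
1 to the zero odd part of k. -/
instance : Subsingleton (S1 k).tri := by
  have h : ∀ i, ∀ d ∈ (S1 k).triPart i, d = 0 := by
    intro i d hd
    funext m
    refine LinearMap.ext_ring ?_
    have h1 := (hd.1 m).1 0 1 (mem_gr_self_zero _)
    rcases parity_cases i with rfl | rfl
    · have h2 := (hd.1 m).2 0 1 (mem_gr_self_zero _) 1
      change ((2 : k) • LinearMap.mul k k) _ _ + _ * ((2 : k) • LinearMap.mul k k) _ _ = 0 at h2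
      simp only [mul_zero, sgn_zero, LinearMap.smul_apply, LinearMap.mul_apply', smul_eq_mul] at h2
      have h3 : (2 : k) * (2 * d m 1) = 0 := by linear_combination h2
      simpa [NeZero.ne (2 : k)] using h3
    · exact mem_gr_self_one h1
  refine ⟨fun d f => Subtype.ext ?_⟩
  have h0 : (S1 k).tri ≤ ⊥ := iSup_le fun i d hd => h i d hd
  rw [(h0 d.2 : d.1 = 0), (h0 f.2 : f.1 = 0)]

variable (S : SymmetricCompositionSuperalgebra k V)

/-- The element `ι_i(1 ⊗ a)` of `𝔤(S₁, S)`. -/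
def inc (i : Fin 3) : V →ₗ[k] MagicAlgebra (S1 k) S :=
  iota (S1 k) S i ∘ₗ TensorProduct.mk k k V 1

lemma inc_apply (i : Fin 3) (a : V) : inc S i a = iota (S1 k) S i (1 ⊗ₜ[k] a) := rfl

lemma inc_mem (i : Fin 3) {j : ZMod 2} {a : V} (ha : a ∈ gr k V j) :
    inc S i a ∈ gr k (MagicAlgebra (S1 k) S) j := by
  have := tmul_mem (mem_gr_self_zero (1 : k)) ha
  rw [zero_add] at this
  exact iota_mem (S1 k) S i this

/-- The coordinate `ι_i(1 ⊗ a) ↦ a` on `𝔤(S₁, S)`. -/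
def coord (i : Fin 3) : MagicAlgebra (S1 k) S →ₗ[k] V :=
  (TensorProduct.lid k V).toLinearMap ∘ₗ comp (S1 k) S i

lemma comp_ext {x y : MagicAlgebra (S1 k) S}
    (ht : triComp' (S1 k) S x = triComp' (S1 k) S y)
    (hc : ∀ i, comp (S1 k) S i x = comp (S1 k) S i y) : x = y :=
  Prod.ext (Prod.ext (Subsingleton.elim _ _) ht) (funext hc)

lemma decomposition (x : MagicAlgebra (S1 k) S) :
    x = ofTri' (S1 k) S (triComp' (S1 k) S x) + ∑ i, inc S i (coord S i x) := by
  have h : ∀ i, inc S i (coord S i x) = iota (S1 k) S i (comp (S1 k) S i x) := fun i =>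
    congrArg (iota (S1 k) S i) ((TensorProduct.lid k V).symm_apply_apply _)
  simp only [h]
  refine comp_ext S ?_ fun j => ?_
  · simp
  · simp [comp_iota]

lemma coord_mem (i : Fin 3) {j : ZMod 2} {x : MagicAlgebra (S1 k) S}
    (hx : x ∈ gr k (MagicAlgebra (S1 k) S) j) : coord S i x ∈ gr k V j := by
  have hu : comp (S1 k) S i x ∈ gr k (k ⊗[k] V) j := hx.2 i trivial
  refine (iSup_le fun l => Submodule.map₂_le.2 fun c hc v hv => ?_ :
    gr k (k ⊗[k] V) j ≤ (gr k V j).comap (TensorProduct.lid k V).toLinearMap) hu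
  simp only [TensorProduct.mk_apply, Submodule.mem_comap, LinearEquiv.coe_coe,
    TensorProduct.lid_tmul]
  rcases parity_cases l with rfl | rfl
  · rw [add_zero] at hv
    exact Submodule.smul_mem _ _ hv
  · rw [mem_gr_self_one hc, zero_smul]
    exact zero_mem _

lemma triComp'_mem {j : ZMod 2} {x : MagicAlgebra (S1 k) S}
    (hx : x ∈ gr k (MagicAlgebra (S1 k) S) j) : triComp' (S1 k) S x ∈ gr k S.tri j := hx.1.2

lemma hom_ext {M : Type*} [AddCommGroup M] [Module k M] {f g : MagicAlgebra (S1 k) S →ₗ[k] M}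
    (ht : ∀ p, ∀ d ∈ gr k S.tri p, f (ofTri' (S1 k) S d) = g (ofTri' (S1 k) S d))
    (hi : ∀ i p, ∀ a ∈ gr k V p, f (inc S i a) = g (inc S i a)) : f = g := by
  refine gr_ext fun j x hx => ?_
  rw [decomposition S x, map_add, map_add, map_sum, map_sum, ht j _ (triComp'_mem S hx),
    Finset.sum_congr rfl fun i _ => hi i j _ (coord_mem S i hx)]

lemma comp_inc (i j : Fin 3) (a : V) :
    comp (S1 k) S i (inc S j a) = if i = j then 1 ⊗ₜ[k] a else 0 := comp_iota _ _ _ _ _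

@[simp] lemma triComp'_inc (i : Fin 3) (a : V) : triComp' (S1 k) S (inc S i a) = 0 := rfl

@[simp] lemma triComp_inc (i : Fin 3) (a : V) : triComp (S1 k) S (inc S i a) = 0 := rfl

lemma bracket_ofTri'_ofTri' {p r : ZMod 2} {d f : S.tri} (hd : d ∈ gr k S.tri p)
    (hf : f ∈ gr k S.tri r) :
    bracket (S1 k) S (ofTri' _ S d) (ofTri' _ S f) = ofTri' _ S (S.triBracket d f) := by
  rw [bracket_apply _ _ (ofTri'_mem _ S hd) (ofTri'_mem _ S hf), diagPart_apply,
    upperPart_apply, upperPart_apply]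
  simp

lemma diagPart_ofTri'_inc (d : S.tri) (i : Fin 3) (a : V) :
    diagPart (S1 k) S (ofTri' _ S d) (inc S i a) = 0 := by
  rw [diagPart_apply]
  simp

lemma diagPart_inc_ofTri' (d : S.tri) (i : Fin 3) (a : V) :
    diagPart (S1 k) S (inc S i a) (ofTri' _ S d) = 0 := by
  rw [diagPart_apply]
  simp

lemma upperPart_inc_ofTri' (d : S.tri) (i : Fin 3) (a : V) :
    upperPart (S1 k) S (inc S i a) (ofTri' _ S d) = 0 := by
  rw [upperPart_apply]
  simp

lemma upperPart_ofTri'_inc (d : S.tri) (i : Fin 3) (a : V) :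
    upperPart (S1 k) S (ofTri' _ S d) (inc S i a) =
      inc S i ((d : Fin 3 → Module.End k V) i a) := by
  rw [upperPart_apply, Finset.sum_eq_single i]
  · simp [comp_inc, signedLTensor_one, ← inc_apply]
  · intro j _ hj
    simp [comp_inc, hj]
  · simp

lemma bracket_ofTri'_inc {p r : ZMod 2} {d : S.tri} (hd : d ∈ gr k S.tri p) (i : Fin 3) {a : V}
    (ha : a ∈ gr k V r) : bracket (S1 k) S (ofTri' _ S d) (inc S i a) =
      inc S i ((d : Fin 3 → Module.End k V) i a) := by
  rw [bracket_apply _ _ (ofTri'_mem _ S hd) (inc_mem S i ha), diagPart_ofTri'_inc,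
    upperPart_ofTri'_inc, upperPart_inc_ofTri', smul_zero, sub_zero, zero_add]

lemma bracket_inc_ofTri' {p r : ZMod 2} {d : S.tri} (hd : d ∈ gr k S.tri p) (i : Fin 3) {a : V}
    (ha : a ∈ gr k V r) : bracket (S1 k) S (inc S i a) (ofTri' _ S d) =
      -(sgn k (r * p) • inc S i ((d : Fin 3 → Module.End k V) i a)) := by
  rw [bracket_apply _ _ (inc_mem S i ha) (ofTri'_mem _ S hd), diagPart_inc_ofTri',
    upperPart_ofTri'_inc, upperPart_inc_ofTri', zero_sub, zero_add]

lemma tensorMul_one {p r : ZMod 2} {a b : V} (ha : a ∈ gr k V p) (hb : b ∈ gr k V r) :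
    tensorMul (S1 k) S (1 ⊗ₜ a) (1 ⊗ₜ b) = 1 ⊗ₜ[k] S.mul a b := by
  rw [tensorMul, signedTensor_apply _ _ _ (mem_gr_self_zero 1) ha (mem_gr_self_zero 1) hb]
  have h : (S1 k).mul 1 1 = 1 := by
    change (HurwitzSuperalgebra.ground k).mul
      ((HurwitzSuperalgebra.ground k).conj (HurwitzSuperalgebra.ground k).one)
      ((HurwitzSuperalgebra.ground k).conj (HurwitzSuperalgebra.ground k).one) = _
    rw [HurwitzSuperalgebra.conj_one, (HurwitzSuperalgebra.ground k).one_mul]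
    rfl
  simp [h]

lemma upperPart_inc_inc {p r : ZMod 2} (i j : Fin 3) {a b : V} (ha : a ∈ gr k V p)
    (hb : b ∈ gr k V r) : upperPart (S1 k) S (inc S i a) (inc S j b) =
      if j = i + 1 then inc S (i + 2) (S.mul a b) else 0 := by
  rw [upperPart_apply, Finset.sum_eq_single i]
  · by_cases h : j = i + 1
    · subst h
      simp [comp_inc, tensorMul_one S ha hb, ← inc_apply]
    · simp [comp_inc, h, Ne.symm h]
  · intro m _ hm
    simp [comp_inc, hm]
  · simp

lemma diagPart_inc_inc_of_ne {i j : Fin 3} (h : i ≠ j) (a b : V) :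
    diagPart (S1 k) S (inc S i a) (inc S j b) = 0 := by
  rw [diagPart_apply]
  have h1 : ∀ m, ¬(m = i ∧ m = j) := fun m hm => h (hm.1.symm.trans hm.2)
  simp only [triComp_inc, triComp'_inc, map_zero, zero_add]
  refine Finset.sum_eq_zero fun m _ => ?_
  by_cases hi : m = i
  · have hj : m ≠ j := fun hj => h1 m ⟨hi, hj⟩
    simp [comp_inc, hj]
  · simp [comp_inc, hi]

/-- The factor 2 is b(1,1) in S_1, the polar form of x². It matches the factor 2 in
`superComm_DL_DL_self`. -/
lemma toTri'_one {p r : ZMod 2} {a b : V} (ha : a ∈ gr k V p) (hb : b ∈ gr k V r) :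
    toTri' (S1 k) S (1 ⊗ₜ a) (1 ⊗ₜ b) = (2 : k) • S.tTri a b := by
  rw [toTri', LinearMap.compr₂_apply,
    signedTensor_apply _ _ _ (mem_gr_self_zero 1) ha (mem_gr_self_zero 1) hb]
  have h : (S1 k).b 1 1 = 2 := by
    change ((2 : k) • LinearMap.mul k k) 1 1 = 2
    simp
  simp [h]

lemma bracket_inc_inc_self {p r : ZMod 2} (i : Fin 3) {a b : V} (ha : a ∈ gr k V p)
    (hb : b ∈ gr k V r) : bracket (S1 k) S (inc S i a) (inc S i b) =
      (2 : k) • ofTri' (S1 k) S ((S.theta ^ (i : ℕ)) (S.tTri a b)) := by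
  have n1 : i ≠ i + 1 := by simp
  rw [bracket_apply _ _ (inc_mem S i ha) (inc_mem S i hb), upperPart_inc_inc S i i ha hb,
    upperPart_inc_inc S i i hb ha, if_neg n1, if_neg n1, smul_zero, sub_zero, add_zero,
    diagPart_apply, Finset.sum_eq_single i]
  · have h : ∀ d, ofTri (S1 k) S d = 0 := fun d => by rw [Subsingleton.elim d 0, map_zero]
    simp [h, comp_inc, toTri'_one S ha hb]
  · intro j _ hj
    simp [comp_inc, hj]
  · simp

lemma bracket_inc_inc_succ {p r : ZMod 2} (i : Fin 3) {a b : V} (ha : a ∈ gr k V p)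
    (hb : b ∈ gr k V r) : bracket (S1 k) S (inc S i a) (inc S (i + 1) b) =
      inc S (i + 2) (S.mul a b) := by
  have n1 : i ≠ i + 1 := by simp
  have n2 : i ≠ i + 1 + 1 := by rw [fin_three_add_one_one]; simp
  rw [bracket_apply _ _ (inc_mem S i ha) (inc_mem S _ hb), upperPart_inc_inc S _ _ ha hb,
    upperPart_inc_inc S _ _ hb ha, if_pos rfl, if_neg n2, smul_zero, sub_zero,
    diagPart_inc_inc_of_ne S n1, zero_add]

lemma bracket_inc_inc_pred {p r : ZMod 2} (i : Fin 3) {a b : V} (ha : a ∈ gr k V p)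
    (hb : b ∈ gr k V r) : bracket (S1 k) S (inc S (i + 1) a) (inc S i b) =
      -(sgn k (p * r) • inc S (i + 2) (S.mul b a)) := by
  have n1 : i + 1 ≠ i := by simp
  have n2 : i ≠ i + 1 + 1 := by rw [fin_three_add_one_one]; simp
  rw [bracket_apply _ _ (inc_mem S _ ha) (inc_mem S i hb), upperPart_inc_inc S _ _ ha hb,
    upperPart_inc_inc S _ _ hb ha, if_pos rfl, if_neg n2, zero_sub,
    diagPart_inc_inc_of_ne S n1, zero_add]

end MagicAlgebra

variable [NeZero (2 : k)]

/-! ### The isomorphism Φ -/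

namespace HurwitzSuperalgebra

variable (C : HurwitzSuperalgebra k V)

/-- The linear map `(d, ι_i(1 ⊗ a_i)) ↦ D_d + ∑ D_i(a_i)`, with values in `End(J)`. -/
def phiEnd : MagicAlgebra (S1 k) C.para →ₗ[k] Module.End k C.J :=
  C.DTri ∘ₗ C.para.tri.subtype ∘ₗ MagicAlgebra.triComp' (S1 k) C.para +
    ∑ i, C.DL i ∘ₗ MagicAlgebra.coord C.para i

lemma phiEnd_apply (x : MagicAlgebra (S1 k) C.para) : C.phiEnd x =
    C.DTri (MagicAlgebra.triComp' (S1 k) C.para x) +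
      ∑ i, C.DL i (MagicAlgebra.coord C.para i x) := by
  simp only [phiEnd, LinearMap.add_apply, LinearMap.sum_apply]
  rfl

lemma phiEnd_ofTri' (d : C.para.tri) :
    C.phiEnd (MagicAlgebra.ofTri' (S1 k) C.para d) = C.DTri d := by
  simp [phiEnd_apply, MagicAlgebra.coord]

lemma phiEnd_inc (i : Fin 3) (a : V) : C.phiEnd (MagicAlgebra.inc C.para i a) = C.DL i a := by
  rw [phiEnd_apply, Finset.sum_eq_single i]
  · simp [MagicAlgebra.coord, MagicAlgebra.comp_inc]
  · intro j _ hj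
    simp [MagicAlgebra.coord, MagicAlgebra.comp_inc, hj]
  · simp

lemma phiEnd_mem {p : ZMod 2} {x : MagicAlgebra (S1 k) C.para}
    (hx : x ∈ gr k (MagicAlgebra (S1 k) C.para) p) : C.phiEnd x ∈ derPart C.jordanMul p := by
  rw [phiEnd_apply]
  exact add_mem (C.DTri_mem (MagicAlgebra.triComp'_mem C.para hx))
    (Submodule.sum_mem _ fun i _ => C.DL_mem i (MagicAlgebra.coord_mem C.para i hx))

/-- The linear map `Φ : 𝔤(S₁, S) → der J`. -/
def phi : MagicAlgebra (S1 k) C.para →ₗ[k] Der C.jordanMul :=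
  C.phiEnd.codRestrict _ fun x =>
    hom_induction (k := k) (fun i _ hx => Submodule.mem_iSup_of_mem i (C.phiEnd_mem hx))
      (fun x y hx hy => by rw [map_add]; exact add_mem hx hy) x

lemma coe_phi (x : MagicAlgebra (S1 k) C.para) : (C.phi x : Module.End k C.J) = C.phiEnd x := rfl

lemma isPhi_phi : C.IsPhi C.phi := by
  refine ⟨fun d => ?_, fun i a => C.phiEnd_inc i a⟩
  rw [coe_phi, phiEnd_ofTri']
  exact ⟨C.DTri_e d, C.DTri_iota d⟩

/-- Because tri(S_1) = 0, the prescribed values determine Φ on a spanning set of 𝔤(S_1, S); each D_d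
is in turn determined by its values on the e_i and ι_i(a), which span J. -/
lemma IsPhi.eq_phi {C : HurwitzSuperalgebra k V}
    {Ψ : MagicAlgebra (S1 k) C.para →ₗ[k] Der C.jordanMul} (h : C.IsPhi Ψ) : Ψ = C.phi := by
  refine MagicAlgebra.hom_ext C.para (fun p d _ => Subtype.ext ?_) fun i p a _ => Subtype.ext ?_
  · rw [coe_phi, phiEnd_ofTri']
    refine C.J_ext (fun i => ?_) fun i j a _ => ?_
    · rw [(h.1 d).1, DTri_e]
    · rw [DTri_iota]
      exact (h.1 d).2 i a
  · rw [coe_phi, phiEnd_inc]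
    exact h.2 i a

lemma phi_injective : Function.Injective C.phi := by
  refine (injective_iff_map_eq_zero _).2 fun x hx => ?_
  have h : C.phiEnd x = 0 := congrArg Subtype.val hx
  rw [phiEnd_apply] at h
  obtain ⟨h1, h2⟩ := C.DTri_add_DL_eq_zero h
  have h1' : MagicAlgebra.triComp' (S1 k) C.para x = 0 := Subtype.ext h1
  rw [MagicAlgebra.decomposition C.para x, h1', map_zero, zero_add]
  refine Finset.sum_eq_zero fun i _ => ?_
  rw [show MagicAlgebra.coord C.para i x = 0 from congrFun h2 i, map_zero]

lemma phi_surjective : Function.Surjective C.phi := by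
  -- The range is a subspace and der J is the sum of its homogeneous parts, so homogeneous
  -- derivations suffice.
  have h : Der C.jordanMul ≤ LinearMap.range C.phiEnd := by
    refine iSup_le fun p X hX => ?_
    obtain ⟨d, hd, a, rfl⟩ := C.exists_eq_DTri_add_DL hX
    refine add_mem ⟨MagicAlgebra.ofTri' (S1 k) C.para ⟨d, Submodule.mem_iSup_of_mem p hd⟩,
      C.phiEnd_ofTri' _⟩ (Submodule.sum_mem _ fun i _ => ⟨_, C.phiEnd_inc i (a i)⟩)
  intro X
  obtain ⟨x, hx⟩ := h X.2
  exact ⟨x, Subtype.ext hx⟩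

lemma phi_bracket (x y : MagicAlgebra (S1 k) C.para) :
    C.phi (MagicAlgebra.bracket (S1 k) C.para x y) =
      derBracket C.jordanMul (C.phi x) (C.phi y) := by
  suffices h : (MagicAlgebra.bracket (S1 k) C.para).compr₂ C.phi =
      (derBracket C.jordanMul).compl₁₂ C.phi C.phi from
    LinearMap.congr_fun (LinearMap.congr_fun h x) y
  have hD : ∀ {p} {d : C.para.tri}, d ∈ gr k C.para.tri p →
      C.DTri d ∈ gr k (Module.End k C.J) p := fun hd => (C.DTri_mem hd).1
  refine MagicAlgebra.hom_ext (M := MagicAlgebra (S1 k) C.para →ₗ[k] Der C.jordanMul) C.para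
    (fun p d hd => ?_) fun i p a ha => ?_
  · refine MagicAlgebra.hom_ext C.para (fun r f hf => ?_) fun i r b hb => ?_
    · refine Subtype.ext ?_
      simp only [LinearMap.compr₂_apply, LinearMap.compl₁₂_apply, derBracket_coe, coe_phi,
        MagicAlgebra.bracket_ofTri'_ofTri' C.para hd hf, phiEnd_ofTri']
      exact (C.superComm_DTri_DTri (fun m => (hd.1 m).1) (fun m => (hf.1 m).1)).symm
    · refine Subtype.ext ?_
      simp only [LinearMap.compr₂_apply, LinearMap.compl₁₂_apply, derBracket_coe, coe_phi,
        MagicAlgebra.bracket_ofTri'_inc C.para hd i hb, phiEnd_ofTri', phiEnd_inc]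
      exact (C.superComm_DTri_DL hd i hb).symm
  · refine MagicAlgebra.hom_ext C.para (fun r f hf => ?_) fun j r b hb => ?_
    · refine Subtype.ext ?_
      simp only [LinearMap.compr₂_apply, LinearMap.compl₁₂_apply, derBracket_coe, coe_phi,
        phiEnd_ofTri', phiEnd_inc]
      have h1 := C.superComm_DTri_DL (d := f) hf i ha
      rw [MagicAlgebra.bracket_inc_ofTri' C.para hf i ha, map_neg, map_smul, phiEnd_inc,
        superComm_skew (C.DL_mem i ha).1 (hD hf)]
      exact congrArg (fun X => -(sgn k (p * r) • X)) h1.symm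
    · refine Subtype.ext ?_
      simp only [LinearMap.compr₂_apply, LinearMap.compl₁₂_apply, derBracket_coe, coe_phi,
        phiEnd_inc]
      rcases fin_three_cases i j with rfl | rfl | rfl
      · rw [MagicAlgebra.bracket_inc_inc_self C.para i ha hb, map_smul, phiEnd_ofTri',
          C.superComm_DL_DL_self i ha hb]
        exact congrArg (fun f => (2 : k) • C.DTri f)
          (funext fun m => C.para.theta_pow_apply i (C.para.tTri a b) m)
      · rw [MagicAlgebra.bracket_inc_inc_succ C.para i ha hb, phiEnd_inc,
          C.superComm_DL_DL_succ i ha hb]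
      -- The pair of indices (i, i+2) is the consecutive pair (i+2, i) reversed, so both sides are
      -- obtained by superanticommutativity.
      · have h1 := MagicAlgebra.bracket_inc_inc_pred C.para (i + 2) ha hb
        have h2 := C.superComm_DL_DL_succ (i + 2) hb ha
        rw [fin_three_add_two_one, fin_three_add_two_two] at h1 h2
        rw [h1, superComm_skew (C.DL_mem i ha).1 (C.DL_mem _ hb).1, h2, map_neg, map_smul,
          phiEnd_inc]

lemma isSuperIso_phi : IsSuperIso (MagicAlgebra.bracket (S1 k) C.para)
    (derBracket C.jordanMul) C.phi :=
  ⟨⟨C.phi_injective, C.phi_surjective⟩, fun _ _ hx => C.phiEnd_mem hx, C.phi_bracket⟩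

end HurwitzSuperalgebra

end Magic

end SuperMagic

end

theorem mainTheorem4 {k : Type*} [Field k] [NeZero (2 : k)] {V : Type*} [AddCommGroup V]
    [Module k V] [SuperMagic.Superspace k V] (C : SuperMagic.HurwitzSuperalgebra k V) :
    SuperMagic.IsLieSuperalgebra (SuperMagic.MagicAlgebra.bracket (SuperMagic.S1 k) C.para) ∧
    SuperMagic.IsLieSuperalgebra (SuperMagic.derBracket C.jordanMul) ∧
    ∃ Φ : SuperMagic.MagicAlgebra (SuperMagic.S1 k) C.para →ₗ[k] SuperMagic.Der C.jordanMul,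
      C.IsPhi Φ ∧ (∀ Ψ, C.IsPhi Ψ → Ψ = Φ) ∧
      SuperMagic.IsSuperIso (SuperMagic.MagicAlgebra.bracket (SuperMagic.S1 k) C.para)
        (SuperMagic.derBracket C.jordanMul) Φ := by
  exact ⟨C.isSuperIso_phi.isLieSuperalgebra (SuperMagic.isLieSuperalgebra_derBracket _),
    SuperMagic.isLieSuperalgebra_derBracket _, C.phi, C.isPhi_phi, fun _ h => h.eq_phi,
    C.isSuperIso_phi⟩
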